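/- Let $n_1,n_2\ge 1$ be integers, $p\in(0,1)$, and write $n=n_1+n_2$, $\alpha=p/(1-p)$. Let $\pi=\mathrm{Bin}(n_1,p)$ (the prior, on $\Theta=\{0,\dots,n_1\}$) and $g=\mathrm{Bin}(n_2,p)$ (the noise), viewed as mass functions, and put $f_\theta(x)=g(x-\theta)$ for $\theta\in\Theta$, $x\in\mathcal X=\{0,\dots,n\}$ (with $g=0$ off $\{0,\dots,n_2\}$). Let $m(x)=\sum_\theta \pi(\theta)f_\theta(x)$ be the marginal; it is the $\mathrm{Bin}(n,p)$ law. The location-family Gibbs sampler is the Markov chain on $\mathcal X$ with transition matrix $$P(x,x')=\sum_{\theta\in\Theta}\pi(\theta)\,\frac{f_\theta(x)}{m(x)}\,f_\theta(x'),$$ which has invariant distribution $m$. For $t\in\mathbb N_0$ let $d_{TV}^{n_1,n_2,p}(t)=\tfrac12\sum_{y\in\mathcal X}|P^t(0,y)-m(y)|$. For $c\in\mathbb R$ put $$L=\log\frac{1}{1-n_2/n},\qquad \tau(c)=\frac{\tfrac12\log(\alpha n)+c}{L}.$$ **Theorem.** Let $(n_{1,N})_N,(n_{2,N})_N$ be sequences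 of positive integers and $(p_N)_N$ a sequence in $(0,1)$, and let $n_N,\alpha_N,L_N,\tau_N(c)$ be the corresponding quantities. Suppose that $n_N\min\{p_N,1-p_N\}\to\infty$ as $N\to\infty$. Let $c\in\mathbb R$, and let $\Phi$ be the standard normal distribution function. 1. For every sequence $(t_N)$ of non-negative integers with $(t_N-\tau_N(c))\,L_N\to0$ (in particular if $t_N=\tau_N(c)$ is an integer for every $N$), $$d_{TV}^{n_{1,N},n_{2,N},p_N}(t_N)\to 2\,\Phi\!\left(\tfrac12e^{-c}\right)-1 .$$ 2. If moreover $n_{2,N}/n_N\to0$, then both $$d_{TV}^{n_{1,N},n_{2,N},p_N}(\lfloor\tau_N(c)\rfloor)\quad\text{and}\quad d_{TV}^{n_{1,N},n_{2,N},p_N}(\lceil\tau_N(c)\rceil)$$ converge to $2\,\Phi\!\left(\tfrac12e^{-c}\right)-1$ (floors and ceilings of negative numbers being read as $0$). -/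

import Mathlib

open Filter Topology ProbabilityTheory

noncomputable section

namespace GibbsSampler

section General

variable {X Θ : Type*} [Fintype X] [Fintype Θ]

/-- The marginal density `m(x) = ∑_θ π(θ) f_θ(x)` on the (finite) sample space `X`, where `prior` is
the mass function of the prior and `f θ` is a probability mass function on `X` for every `θ`. -/
def marginal (prior : Θ → ℝ) (f : Θ → X → ℝ) (x : X) : ℝ :=
  ∑ θ, prior θ * f θ x

/-- The posterior density `π(θ | x) = f_θ(x) / m(x)`, taken with respect to the prior. -/
def posterior (prior : Θ → ℝ) (f : Θ → X → ℝ) (θ : Θ) (x : X) : ℝ :=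
  f θ x / marginal prior f x

/-- The transition matrix of the two-component Gibbs sampler observed on `X`: from `x`, draw `θ`
from the posterior given `x`, then draw the new state from `f θ`. -/
def kernel (prior : Θ → ℝ) (f : Θ → X → ℝ) : Matrix X X ℝ :=
  Matrix.of fun x x' => ∑ θ, prior θ * posterior prior f θ x * f θ x'

/-- The marginal is invariant for the Gibbs sampler. -/
theorem marginal_vecMul_kernel (prior : Θ → ℝ) (f : Θ → X → ℝ)
    (hm : ∀ x, marginal prior f x ≠ 0) (hf : ∀ θ, ∑ x, f θ x = 1) :
    Matrix.vecMul (marginal prior f) (kernel prior f) = marginal prior f := by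
  funext x'
  have h : ∀ x, marginal prior f x * kernel prior f x x'
      = ∑ θ, f θ x * (prior θ * f θ x') := by
    intro x
    simp only [kernel, posterior, Matrix.of_apply, Finset.mul_sum]
    refine Finset.sum_congr rfl fun θ _ => ?_
    have := hm x
    field_simp
  simp only [Matrix.vecMul, dotProduct, h]
  rw [Finset.sum_comm]
  simp only [← Finset.sum_mul, hf, one_mul]
  rfl

/-- Total variation distance between two mass functions on a finite set. -/
def tvDist (μ ν : X → ℝ) : ℝ :=
  (1 / 2) * ∑ x, |μ x - ν x|

end General

/-- The mass function of `Bin(n, p)`. -/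
def binomialMass (n : ℕ) (p : unitInterval) (k : ℕ) : ℝ :=
  (binomial n p).real {k}

/-- The prior `Bin(n₁, p)` on `Θ = {0, …, n₁}`. -/
def binPrior (n₁ : ℕ) (p : unitInterval) (θ : Fin (n₁ + 1)) : ℝ :=
  binomialMass n₁ p θ

/-- The location family `f_θ(x) = g(x - θ)` on `{0, …, n₁ + n₂}`, with `g` the mass function of
`Bin(n₂, p)` (which vanishes at negative integers). -/
def binLocation (n₁ n₂ : ℕ) (p : unitInterval) (θ : Fin (n₁ + 1)) (x : Fin (n₁ + n₂ + 1)) : ℝ :=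
  if (θ : ℕ) ≤ x then binomialMass n₂ p ((x : ℕ) - θ) else 0

/-- The invariant distribution `m` of the Binomial Gibbs sampler, the marginal on
`{0, …, n₁ + n₂}`. -/
def binMarginal (n₁ n₂ : ℕ) (p : unitInterval) : Fin (n₁ + n₂ + 1) → ℝ :=
  marginal (binPrior n₁ p) (binLocation n₁ n₂ p)

/-- The invariant distribution is `Bin(n₁ + n₂, p)`. -/
theorem binMarginal_eq (n₁ n₂ : ℕ) (p : unitInterval) (x : Fin (n₁ + n₂ + 1)) :
    binMarginal n₁ n₂ p x = binomialMass (n₁ + n₂) p x := by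
  simp only [binMarginal, marginal, binPrior, binLocation, binomialMass, binomial_real_singleton]
  rw [Fin.sum_univ_eq_sum_range (fun k => ((n₁.choose k : ℝ) * (p : ℝ) ^ k * (1 - (p : ℝ)) ^ (n₁ - k))
    * (if k ≤ (x : ℕ) then ((n₂.choose (x - k) : ℝ) * (p : ℝ) ^ ((x : ℕ) - k)
        * (1 - (p : ℝ)) ^ (n₂ - (x - k))) else 0)) (n₁ + 1)]
  rw [Nat.add_choose_eq, Finset.Nat.sum_antidiagonal_eq_sum_range_succ
    (fun i j => n₁.choose i * n₂.choose j)]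
  push_cast
  rw [Finset.sum_mul, Finset.sum_mul]
  have key : ∀ k, ((n₁.choose k : ℝ) * (p : ℝ) ^ k * (1 - (p : ℝ)) ^ (n₁ - k))
      * (if k ≤ (x : ℕ) then ((n₂.choose (x - k) : ℝ) * (p : ℝ) ^ ((x : ℕ) - k)
        * (1 - (p : ℝ)) ^ (n₂ - (x - k))) else 0)
      = if k ≤ (x : ℕ) ∧ k ≤ n₁ then (n₁.choose k : ℝ) * (n₂.choose (x - k) : ℝ) * (p : ℝ) ^ (x : ℕ)
        * (1 - (p : ℝ)) ^ (n₁ + n₂ - x) else 0 := by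
    intro k
    by_cases h1 : k ≤ (x : ℕ)
    · by_cases h2 : k ≤ n₁
      · by_cases h3 : (x : ℕ) - k ≤ n₂
        · rw [if_pos h1, if_pos ⟨h1, h2⟩,
            show (x : ℕ) = k + (x - k) by omega,
            show n₁ + n₂ - (k + ((x : ℕ) - k)) = (n₁ - k) + (n₂ - (x - k)) by omega]
          simp only [pow_add, Nat.add_sub_cancel_left]
          ring
        · simp [Nat.choose_eq_zero_of_lt (not_le.mp h3)]
      · simp [Nat.choose_eq_zero_of_lt (not_le.mp h2)]
    · simp [h1]
  have key2 : ∀ k ∈ Finset.range ((x : ℕ) + 1),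
      (n₁.choose k : ℝ) * (n₂.choose (x - k) : ℝ) * (p : ℝ) ^ (x : ℕ)
        * (1 - (p : ℝ)) ^ (n₁ + n₂ - x)
      = if k ≤ (x : ℕ) ∧ k ≤ n₁ then (n₁.choose k : ℝ) * (n₂.choose (x - k) : ℝ) * (p : ℝ) ^ (x : ℕ)
        * (1 - (p : ℝ)) ^ (n₁ + n₂ - x) else 0 := by
    intro k hk
    have h1 : k ≤ (x : ℕ) := by simpa [Nat.lt_succ_iff] using hk
    by_cases h2 : k ≤ n₁
    · simp [h1, h2]
    · simp [Nat.choose_eq_zero_of_lt (not_le.mp h2)]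
  rw [Finset.sum_congr rfl fun k _ => key k, Finset.sum_congr rfl key2,
    ← Finset.sum_filter, ← Finset.sum_filter]
  refine Finset.sum_congr ?_ fun _ _ => rfl
  ext k
  simp only [Finset.mem_filter, Finset.mem_range]
  omega

/-- The transition matrix of the Binomial Gibbs sampler on `{0, …, n₁ + n₂}`. -/
def binKernel (n₁ n₂ : ℕ) (p : unitInterval) :
    Matrix (Fin (n₁ + n₂ + 1)) (Fin (n₁ + n₂ + 1)) ℝ :=
  kernel (binPrior n₁ p) (binLocation n₁ n₂ p)

/-- Total variation distance from equilibrium of the Binomial Gibbs sampler after `t` steps started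
from `0`. -/
def dTV (n₁ n₂ : ℕ) (p : unitInterval) (t : ℕ) : ℝ :=
  tvDist ((binKernel n₁ n₂ p ^ t) 0) (binMarginal n₁ n₂ p)

/-- The odds `α = p / (1 - p)`. -/
def odds (p : unitInterval) : ℝ := (p : ℝ) / (1 - p)

/-- The rate `log (1 / (1 - n₂ / n))` with `n = n₁ + n₂`. -/
def rate (n₁ n₂ : ℕ) : ℝ :=
  Real.log (1 / (1 - (n₂ : ℝ) / ((n₁ : ℝ) + n₂)))

/-- The (real) target time `(½ log (α n) + c) / log (1 / (1 - n₂ / n))` with `n = n₁ + n₂`. -/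
def targetTime (n₁ n₂ : ℕ) (p : unitInterval) (c : ℝ) : ℝ :=
  ((1 / 2) * Real.log (odds p * ((n₁ : ℝ) + n₂)) + c) / rate n₁ n₂

/-- The distribution function of the standard normal law. -/
def stdNormalCDF (x : ℝ) : ℝ := cdf (gaussianReal 0 1) x

end GibbsSampler

end

/-! View a `Bin(n, p)` variable as the sum of `n = n₁ + n₂` Bernoulli coordinates. A Gibbs step
keeps a uniformly chosen set of `n₁` coordinates and refreshes the other `n₂`. Started from all
zeros, the chain after `t` steps is a mixture of `Bin(n - u, p)`, where `u` counts coordinates never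
refreshed (`exists_mixture`). Its mean is `M = n (n₁/n)^t`, and sampling without replacement gives
`E[u(u-1)] ≤ M²`, hence `Var u ≤ M`.

The likelihood ratio of `Bin(n - u, p)` to `Bin(n, p)` decreases in the state, so the total
variation distance is a one-sided Kolmogorov distance (`half_sum_abs_mixMass_sub`). This is why
convergence in law suffices.

Centre at `np` and scale by `σ = √(np(1-p))`. The stationary law tends to `N(0,1)`. In the mixture
`u` may be replaced by `M`, which shifts the limit to `N(-a,1)` with `a = lim pM/σ`
(`tendsto_charFun_scaledLaw_mixMass`). The supremum of `Φ(x+a) - Φ(x)` is `2Φ(a/2) - 1`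
(`tendsto_kolmogorov`), and the target time is chosen so that `a = e^{-c}` (`mul_mean_div_sqrt_eq`).
-/

namespace GibbsSampler

open Finset MeasureTheory

/-! ### Binomial masses. -/

/-- The binomial mass function, written through the odds `p / (1 - p)`. -/
noncomputable def binMass (p : ℝ) (j y : ℕ) : ℝ := (j.choose y : ℝ) * (p / (1 - p)) ^ y * (1 - p) ^ j

lemma binMass_eq (p : ℝ) (hp : p < 1) (j y : ℕ) :
    binMass p j y = (j.choose y : ℝ) * p ^ y * (1 - p) ^ (j - y) := by
  have hq : (1 - p) ≠ 0 := by linarith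
  rcases le_or_gt y j with h | h
  · obtain ⟨k, rfl⟩ := Nat.exists_eq_add_of_le h
    rw [binMass, Nat.add_sub_cancel_left, div_pow, pow_add]
    field_simp
  · simp [binMass, Nat.choose_eq_zero_of_lt h]

lemma binomialMass_eq_binMass (n : ℕ) (p : unitInterval) (hp : (p : ℝ) < 1) (k : ℕ) :
    binomialMass n p k = binMass p n k := by
  rw [binMass_eq _ hp, binomialMass, binomial_real_singleton]

lemma binMass_nonneg {p : ℝ} (h0 : 0 ≤ p) (h1 : p < 1) (j y : ℕ) : 0 ≤ binMass p j y := by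
  have : 0 < 1 - p := by linarith
  unfold binMass; positivity

lemma binMass_pos {p : ℝ} (h0 : 0 < p) (h1 : p < 1) {j y : ℕ} (h : y ≤ j) :
    0 < binMass p j y := by
  have : 0 < 1 - p := by linarith
  have : 0 < (j.choose y : ℝ) := by exact_mod_cast Nat.choose_pos h
  unfold binMass; positivity

lemma binMass_eq_zero (p : ℝ) {j y : ℕ} (h : j < y) : binMass p j y = 0 := by
  simp [binMass, Nat.choose_eq_zero_of_lt h]

lemma sum_binMass {p : ℝ} (hp : p < 1) {j n : ℕ} (h : j ≤ n) :
    ∑ y ∈ range (n + 1), binMass p j y = 1 := by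
  have : ∑ y ∈ range (j + 1), binMass p j y = 1 := by
    have h2 := add_pow p (1 - p) j
    rw [add_sub_cancel, one_pow] at h2
    rw [h2]
    exact sum_congr rfl fun y _ => by rw [binMass_eq p hp]; ring
  rw [← this]
  symm
  refine sum_subset (by intro x; simp; omega) fun x _ hx => binMass_eq_zero p ?_
  simpa using hx

/-- In odds form every term carries the same powers, so only Vandermonde's identity remains. -/
lemma binMass_conv (p : ℝ) (a c y : ℕ) :
    ∑ k ∈ antidiagonal y, binMass p a k.1 * binMass p c k.2 = binMass p (a + c) y := by
  unfold binMass
  rw [Nat.add_choose_eq]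
  push_cast
  rw [sum_mul, sum_mul]
  refine sum_congr rfl fun k hk => ?_
  rw [← mem_antidiagonal.mp hk, pow_add, pow_add]
  ring

/-- Both sides count pairs of disjoint subsets of sizes `a` and `b`. -/
lemma choose_mul_choose_sub_comm (n a b : ℕ) :
    n.choose a * (n - a).choose b = n.choose b * (n - b).choose a := by
  have h1 := Nat.choose_mul (n := n) (Nat.le_add_right a b)
  have h2 := Nat.choose_mul (n := n) (Nat.le_add_left b a)
  rw [Nat.add_sub_cancel_left] at h1
  rw [Nat.add_sub_cancel] at h2
  rw [← h1, ← h2, Nat.choose_symm_add]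

/-! ### Hypergeometric weights and their factorial moments. -/

/-- The hypergeometric probability of choosing `v` elements from the first of two classes of sizes
`n₁`, `n₂` and `w` elements from the second. -/
noncomputable def hyperMass (n₁ n₂ v w : ℕ) : ℝ :=
  (n₁.choose v : ℝ) * n₂.choose w / (n₁ + n₂).choose (v + w)

lemma hyperMass_nonneg (n₁ n₂ v w : ℕ) : 0 ≤ hyperMass n₁ n₂ v w := by
  unfold hyperMass; positivity

lemma sum_hyperMass_mul (n₁ n₂ u : ℕ) (F : ℕ → ℝ) :
    ∑ k ∈ antidiagonal u, hyperMass n₁ n₂ k.1 k.2 * F k.1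
      = (∑ k ∈ antidiagonal u, (n₁.choose k.1 : ℝ) * n₂.choose k.2 * F k.1)
        / (n₁ + n₂).choose u := by
  rw [sum_div]
  refine sum_congr rfl fun k hk => ?_
  rw [hyperMass, mem_antidiagonal.mp hk]
  ring

lemma sum_choose_mul_choose (n₁ n₂ u : ℕ) :
    ∑ k ∈ antidiagonal u, (n₁.choose k.1 : ℝ) * n₂.choose k.2 = (n₁ + n₂).choose u := by
  rw [Nat.add_choose_eq]; push_cast; rfl

/-- Absorption, `x * choose (m+1) x = (m+1) * choose m (x-1)`, removes one factor of `x`. Used once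
it gives the mean, twice the second factorial moment. -/
lemma sum_choose_mul_choose_mul_succ (m n₂ k : ℕ) (F : ℕ → ℝ) :
    ∑ x ∈ antidiagonal (k + 1), ((m + 1).choose x.1 : ℝ) * n₂.choose x.2 * (x.1 * F x.1)
      = (m + 1) * ∑ x ∈ antidiagonal k, (m.choose x.1 : ℝ) * n₂.choose x.2 * F (x.1 + 1) := by
  rw [Nat.sum_antidiagonal_succ, mul_sum]
  simp only [Nat.cast_zero, zero_mul, mul_zero, zero_add]
  refine sum_congr rfl fun x _ => ?_
  have h : ((m + 1 : ℕ) : ℝ) * m.choose x.1 = (m + 1).choose (x.1 + 1) * ((x.1 + 1 : ℕ) : ℝ) := by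
    exact_mod_cast Nat.add_one_mul_choose_eq m x.1
  calc _ = ((m + 1).choose (x.1 + 1) * ((x.1 + 1 : ℕ) : ℝ)) * n₂.choose x.2 * F (x.1 + 1) := by ring
    _ = _ := by rw [← h]; push_cast; ring

lemma cast_succ_mul_choose (n k : ℕ) :
    ((n : ℝ) + 1) * n.choose k = (n + 1).choose (k + 1) * ((k : ℝ) + 1) := by
  exact_mod_cast Nat.add_one_mul_choose_eq n k

lemma sum_choose_mul_choose_mul_id (n₁ n₂ u : ℕ) :
    ((n₁ : ℝ) + n₂) * ∑ k ∈ antidiagonal u, (n₁.choose k.1 : ℝ) * n₂.choose k.2 * k.1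
      = n₁ * u * (n₁ + n₂).choose u := by
  rcases n₁ with _ | m
  · simp only [Nat.cast_zero, zero_mul]
    rw [sum_eq_zero, mul_zero]
    rintro ⟨a, b⟩ _
    rcases a with _ | a <;> simp
  rcases u with _ | k
  · simp
  have h := sum_choose_mul_choose_mul_succ m n₂ k (fun _ => 1)
  simp only [mul_one] at h
  rw [h, sum_choose_mul_choose]
  have h2 := cast_succ_mul_choose (m + n₂) k
  rw [show m + 1 + n₂ = m + n₂ + 1 by ring]
  push_cast at h2 ⊢
  linear_combination ((m : ℝ) + 1) * h2

lemma sum_choose_mul_choose_mul_descFactorial (n₁ n₂ u : ℕ) :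
    ((n₁ : ℝ) + n₂) * ((n₁ : ℝ) + n₂ - 1) *
      ∑ k ∈ antidiagonal u, (n₁.choose k.1 : ℝ) * n₂.choose k.2 * (k.1 * ((k.1 : ℝ) - 1))
      = n₁ * ((n₁ : ℝ) - 1) * (u * ((u : ℝ) - 1)) * (n₁ + n₂).choose u := by
  rcases n₁ with _ | m
  · simp only [Nat.cast_zero, zero_mul]
    rw [sum_eq_zero, mul_zero]
    rintro ⟨a, b⟩ _
    rcases a with _ | a <;> simp
  rcases u with _ | k
  · simp
  rw [sum_choose_mul_choose_mul_succ m n₂ k (fun x => (x : ℝ) - 1)]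
  have h1 := sum_choose_mul_choose_mul_id m n₂ k
  have h2 := cast_succ_mul_choose (m + n₂) k
  rw [show m + 1 + n₂ = m + n₂ + 1 by ring]
  push_cast at h1 h2 ⊢
  simp only [add_sub_cancel_right]
  linear_combination ((m : ℝ) + 1 + n₂) * (m + 1) * h1 + (m + 1) * m * k * h2

lemma sum_hyperMass {n₁ n₂ u : ℕ} (hu : u ≤ n₁ + n₂) :
    ∑ k ∈ antidiagonal u, hyperMass n₁ n₂ k.1 k.2 = 1 := by
  have h : ((n₁ + n₂).choose u : ℝ) ≠ 0 := by exact_mod_cast (Nat.choose_pos hu).ne'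
  have := sum_hyperMass_mul n₁ n₂ u (fun _ => 1)
  simp only [mul_one] at this
  rw [this, sum_choose_mul_choose, div_self h]

lemma sum_hyperMass_mul_id {n₁ n₂ u : ℕ} (hu : u ≤ n₁ + n₂) (hn : 0 < n₁) :
    ∑ k ∈ antidiagonal u, hyperMass n₁ n₂ k.1 k.2 * (k.1 : ℝ)
      = (n₁ : ℝ) / ((n₁ : ℝ) + n₂) * u := by
  have h : ((n₁ + n₂).choose u : ℝ) ≠ 0 := by exact_mod_cast (Nat.choose_pos hu).ne'
  have hn' : ((n₁ : ℝ) + n₂) ≠ 0 := by positivity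
  rw [sum_hyperMass_mul n₁ n₂ u (fun k => (k : ℝ)), div_mul_eq_mul_div, div_eq_div_iff h hn']
  linear_combination sum_choose_mul_choose_mul_id n₁ n₂ u

/-- Without replacement the second draw succeeds with probability `(n₁-1)/(n-1) ≤ n₁/n`: draws are
negatively correlated. -/
lemma sum_hyperMass_mul_descFactorial_le {n₁ n₂ u : ℕ} (hu : u ≤ n₁ + n₂) (hn₁ : 0 < n₁)
    (hn₂ : 0 < n₂) :
    ∑ k ∈ antidiagonal u, hyperMass n₁ n₂ k.1 k.2 * (k.1 * ((k.1 : ℝ) - 1))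
      ≤ ((n₁ : ℝ) / ((n₁ : ℝ) + n₂)) ^ 2 * (u * ((u : ℝ) - 1)) := by
  have h : ((n₁ + n₂).choose u : ℝ) ≠ 0 := by exact_mod_cast (Nat.choose_pos hu).ne'
  have h1 : (1 : ℝ) ≤ n₁ := by exact_mod_cast hn₁
  have h2 : (1 : ℝ) ≤ n₂ := by exact_mod_cast hn₂
  have hn' : ((n₁ : ℝ) + n₂) ≠ 0 := by positivity
  have hn1 : 0 < ((n₁ : ℝ) + n₂) - 1 := by linarith
  have hu0 : 0 ≤ (u : ℝ) * ((u : ℝ) - 1) := by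
    rcases u with _ | k
    · simp
    · push_cast; rw [add_sub_cancel_right]; positivity
  have key : ∑ k ∈ antidiagonal u, hyperMass n₁ n₂ k.1 k.2 * (k.1 * ((k.1 : ℝ) - 1))
      = (n₁ : ℝ) / ((n₁ : ℝ) + n₂) * (((n₁ : ℝ) - 1) / ((n₁ : ℝ) + n₂ - 1))
        * (u * ((u : ℝ) - 1)) := by
    rw [sum_hyperMass_mul n₁ n₂ u (fun k => k * ((k : ℝ) - 1)), div_mul_div_comm,
      div_mul_eq_mul_div, div_eq_div_iff h (by positivity)]
    linear_combination sum_choose_mul_choose_mul_descFactorial n₁ n₂ u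
  rw [key, sq]
  refine mul_le_mul_of_nonneg_right (mul_le_mul_of_nonneg_left ?_ (by positivity)) hu0
  rw [div_le_div_iff₀ hn1 (by positivity)]
  nlinarith

/-! ### One Gibbs step acting on binomial laws. -/

/-- The explicit likelihood ratio serves twice: in the posterior computation, and for its
monotonicity in `y`. -/
lemma binMass_sub_eq {p : ℝ} (hp : p < 1) {n u : ℕ} (hu : u ≤ n) (y : ℕ) :
    binMass p (n - u) y
      = binMass p n y * (((n - y).choose u : ℝ) / ((n.choose u : ℝ) * (1 - p) ^ u)) := by
  have hq : 1 - p ≠ 0 := by linarith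
  have hc : (n.choose u : ℝ) ≠ 0 := by exact_mod_cast (Nat.choose_pos hu).ne'
  have h : (n.choose u : ℝ) * (n - u).choose y = n.choose y * (n - y).choose u := by
    exact_mod_cast choose_mul_choose_sub_comm n u y
  obtain ⟨k, rfl⟩ := Nat.exists_eq_add_of_le hu
  rw [binMass, binMass, mul_div_assoc', eq_div_iff (by positivity)]
  rw [Nat.add_sub_cancel_left] at h ⊢
  rw [pow_add]
  linear_combination (p / (1 - p)) ^ y * (1 - p) ^ k * (1 - p) ^ u * h

/-- After the likelihood ratio is inserted, only `choose (n - (θ+j)) u` couples `θ` and `j`.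
Vandermonde splits it: of the `u` frozen zeros, `k.1` fall in the kept block and `k.2` in the
refreshed one. -/
lemma binMass_sub_mul_posterior {p : ℝ} (hp0 : 0 < p) (hp : p < 1) {n₁ n₂ u θ j : ℕ}
    (hu : u ≤ n₁ + n₂) (hθ : θ ≤ n₁) (hj : j ≤ n₂) :
    binMass p (n₁ + n₂ - u) (θ + j)
        * (binMass p n₁ θ * binMass p n₂ j / binMass p (n₁ + n₂) (θ + j))
      = ∑ k ∈ antidiagonal u,
          hyperMass n₁ n₂ k.1 k.2 * (binMass p (n₁ - k.1) θ * binMass p (n₂ - k.2) j) := by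
  have hq : 1 - p ≠ 0 := by linarith
  have hc : ((n₁ + n₂).choose u : ℝ) ≠ 0 := by exact_mod_cast (Nat.choose_pos hu).ne'
  have hb := (binMass_pos hp0 hp (show θ + j ≤ n₁ + n₂ by omega)).ne'
  have hV : ((n₁ + n₂ - (θ + j)).choose u : ℝ)
      = ∑ k ∈ antidiagonal u, ((n₁ - θ).choose k.1 : ℝ) * (n₂ - j).choose k.2 := by
    rw [show n₁ + n₂ - (θ + j) = (n₁ - θ) + (n₂ - j) by omega, sum_choose_mul_choose]
  have e : binMass p (n₁ + n₂ - u) (θ + j)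
        * (binMass p n₁ θ * binMass p n₂ j / binMass p (n₁ + n₂) (θ + j))
      = binMass p n₁ θ * binMass p n₂ j * ((n₁ + n₂ - (θ + j)).choose u : ℝ)
        / (((n₁ + n₂).choose u : ℝ) * (1 - p) ^ u) := by
    rw [binMass_sub_eq hp hu]
    field_simp
  rw [e, hV, mul_sum, sum_div]
  refine sum_congr rfl fun k hk => ?_
  have hk' := mem_antidiagonal.mp hk
  by_cases h1 : k.1 ≤ n₁
  · by_cases h2 : k.2 ≤ n₂
    · rw [binMass_sub_eq hp h1, binMass_sub_eq hp h2, hyperMass, hk', ← hk', pow_add]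
      have c1 : (n₁.choose k.1 : ℝ) ≠ 0 := by exact_mod_cast (Nat.choose_pos h1).ne'
      have c2 : (n₂.choose k.2 : ℝ) ≠ 0 := by exact_mod_cast (Nat.choose_pos h2).ne'
      rw [hk']
      field_simp
    · simp [hyperMass, Nat.choose_eq_zero_of_lt (not_le.mp h2),
        Nat.choose_eq_zero_of_lt (show n₂ - j < k.2 by omega)]
  · simp [hyperMass, Nat.choose_eq_zero_of_lt (not_le.mp h1),
        Nat.choose_eq_zero_of_lt (show n₁ - θ < k.1 by omega)]

lemma sum_range_ite_sub {n₁ n₂ θ : ℕ} (hθ : θ ≤ n₁) (f : ℕ → ℝ) (hf : ∀ j, n₂ < j → f j = 0) :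
    ∑ x ∈ range (n₁ + n₂ + 1), (if θ ≤ x then f (x - θ) else 0) = ∑ j ∈ range (n₂ + 1), f j := by
  rw [show n₁ + n₂ + 1 = θ + (n₁ + n₂ + 1 - θ) by omega, sum_range_add,
    sum_eq_zero (fun x hx => if_neg (by simpa using hx)), zero_add]
  simp only [Nat.le_add_right, if_true, Nat.add_sub_cancel_left]
  symm
  refine sum_subset (by intro x; simp; omega) fun x _ hx => hf x ?_
  simp at hx; omega

lemma sum_range_mul_ite {m y : ℕ} (a c : ℕ → ℝ) (ha : ∀ j, m < j → a j = 0) :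
    ∑ θ ∈ range (m + 1), a θ * (if θ ≤ y then c (y - θ) else 0)
      = ∑ k ∈ antidiagonal y, a k.1 * c k.2 := by
  rw [Nat.sum_antidiagonal_eq_sum_range_succ (fun i j => a i * c j)]
  simp only [mul_ite, mul_zero]
  rw [← sum_filter]
  have : (range (m + 1)).filter (· ≤ y) ⊆ range (y + 1) := by
    intro x; simp
  refine sum_subset this fun x hx hx' => ?_
  rw [ha x, zero_mul]
  simp at hx hx'
  by_contra h
  exact absurd (hx' (by omega)) (by omega)

lemma binPrior_eq {n₁ : ℕ} {p : unitInterval} (hp : (p : ℝ) < 1) (θ : Fin (n₁ + 1)) :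
    binPrior n₁ p θ = binMass p n₁ θ := binomialMass_eq_binMass _ _ hp _

lemma binLocation_eq {n₁ n₂ : ℕ} {p : unitInterval} (hp : (p : ℝ) < 1) (θ : Fin (n₁ + 1))
    (x : Fin (n₁ + n₂ + 1)) :
    binLocation n₁ n₂ p θ x = if (θ : ℕ) ≤ x then binMass p n₂ ((x : ℕ) - θ) else 0 := by
  simp only [binLocation, binomialMass_eq_binMass _ _ hp]

lemma sum_binMass_mul_posterior {n₁ n₂ u : ℕ} {p : unitInterval} (hp0 : 0 < (p : ℝ))
    (hp : (p : ℝ) < 1) (hu : u ≤ n₁ + n₂) (θ : Fin (n₁ + 1)) :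
    ∑ x : Fin (n₁ + n₂ + 1), binMass p (n₁ + n₂ - u) x
        * (binPrior n₁ p θ * posterior (binPrior n₁ p) (binLocation n₁ n₂ p) θ x)
      = ∑ k ∈ antidiagonal u, hyperMass n₁ n₂ k.1 k.2 * binMass p (n₁ - k.1) θ := by
  have hθ : (θ : ℕ) ≤ n₁ := Nat.lt_succ_iff.mp θ.2
  set g : ℕ → ℝ := fun j => binMass p (n₁ + n₂ - u) (θ + j)
    * (binMass p n₁ θ * binMass p n₂ j / binMass p (n₁ + n₂) (θ + j)) with hg
  have e : ∀ x : Fin (n₁ + n₂ + 1), binMass p (n₁ + n₂ - u) x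
        * (binPrior n₁ p θ * posterior (binPrior n₁ p) (binLocation n₁ n₂ p) θ x)
      = (fun x : ℕ => if (θ : ℕ) ≤ x then g (x - θ) else 0) x := by
    intro x
    have hm : marginal (binPrior n₁ p) (binLocation n₁ n₂ p) x = binMass p (n₁ + n₂) x := by
      rw [← binomialMass_eq_binMass _ _ hp, ← binMarginal_eq]; rfl
    rw [posterior, hm, binPrior_eq hp, binLocation_eq hp]
    dsimp only
    split_ifs with h
    · rw [hg]
      dsimp only
      rw [Nat.add_sub_cancel' h]; ring
    · simp
  rw [sum_congr rfl fun x _ => e x,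
    Fin.sum_univ_eq_sum_range (fun x : ℕ => if (θ : ℕ) ≤ x then g (x - θ) else 0),
    sum_range_ite_sub hθ g (fun j hj => by simp [hg, binMass_eq_zero (p : ℝ) hj])]
  rw [sum_congr rfl fun j hj => binMass_sub_mul_posterior hp0 hp hu hθ
    (Nat.lt_succ_iff.mp (mem_range.mp hj)), sum_comm]
  refine sum_congr rfl fun k _ => ?_
  rw [← mul_sum, ← mul_sum, sum_binMass hp (Nat.sub_le _ _), mul_one]

/-- The fresh `Bin(n₂, p)` noise convolves with `Bin(n₁ - k.1, p)` to give `Bin(n - k.1, p)`, so a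
step only replaces `u` by the hypergeometric `k.1`. -/
lemma sum_binMass_mul_binKernel {n₁ n₂ u : ℕ} {p : unitInterval} (hp0 : 0 < (p : ℝ))
    (hp : (p : ℝ) < 1) (hu : u ≤ n₁ + n₂) (y : Fin (n₁ + n₂ + 1)) :
    ∑ x : Fin (n₁ + n₂ + 1), binMass p (n₁ + n₂ - u) x * binKernel n₁ n₂ p x y
      = ∑ k ∈ antidiagonal u, hyperMass n₁ n₂ k.1 k.2 * binMass p (n₁ + n₂ - k.1) y := by
  have e : ∀ x : Fin (n₁ + n₂ + 1), binMass p (n₁ + n₂ - u) x * binKernel n₁ n₂ p x y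
      = ∑ θ, binMass p (n₁ + n₂ - u) x
        * (binPrior n₁ p θ * posterior (binPrior n₁ p) (binLocation n₁ n₂ p) θ x)
        * binLocation n₁ n₂ p θ y := by
    intro x
    simp only [binKernel, kernel, Matrix.of_apply, mul_sum]
    exact sum_congr rfl fun θ _ => by ring
  rw [sum_congr rfl fun x _ => e x, sum_comm]
  simp only [← sum_mul, sum_binMass_mul_posterior hp0 hp hu]
  simp only [sum_mul]
  rw [sum_comm]
  refine sum_congr rfl fun k _ => ?_
  simp only [mul_assoc, ← mul_sum]
  by_cases h1 : k.1 ≤ n₁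
  · congr 1
    simp only [binLocation_eq hp]
    rw [Fin.sum_univ_eq_sum_range (fun θ : ℕ => binMass p (n₁ - k.1) θ
      * (if θ ≤ (y : ℕ) then binMass p n₂ ((y : ℕ) - θ) else 0)),
      sum_range_mul_ite _ _ (fun j hj => binMass_eq_zero (p : ℝ) (by omega)), binMass_conv]
    congr 1; omega
  · simp [hyperMass, Nat.choose_eq_zero_of_lt (not_le.mp h1)]

/-- The law of the Gibbs sampler started from `0` is a mixture of binomial laws: `u` counts the
coordinates that have not been refreshed after `t` steps. -/
theorem exists_mixture {n₁ n₂ : ℕ} (hn₁ : 0 < n₁) (hn₂ : 0 < n₂) {p : unitInterval}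
    (hp0 : 0 < (p : ℝ)) (hp : (p : ℝ) < 1) (t : ℕ) :
    ∃ w : ℕ → ℝ, (∀ u, 0 ≤ w u) ∧ ∑ u ∈ range (n₁ + n₂ + 1), w u = 1 ∧
      ∑ u ∈ range (n₁ + n₂ + 1), w u * (u : ℝ)
        = ((n₁ : ℝ) + n₂) * ((n₁ : ℝ) / ((n₁ : ℝ) + n₂)) ^ t ∧
      ∑ u ∈ range (n₁ + n₂ + 1), w u * (u * ((u : ℝ) - 1))
        ≤ (((n₁ : ℝ) + n₂) * ((n₁ : ℝ) / ((n₁ : ℝ) + n₂)) ^ t) ^ 2 ∧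
      ∀ y : Fin (n₁ + n₂ + 1), (binKernel n₁ n₂ p ^ t) 0 y
        = ∑ u ∈ range (n₁ + n₂ + 1), w u * binMass p (n₁ + n₂ - u) y := by
  induction t with
  | zero =>
    -- The point mass at `0` is `Bin(0, p)`: no coordinate has been refreshed, so `u = n`.
    refine ⟨fun u => if u = n₁ + n₂ then 1 else 0, fun u => by dsimp only; split_ifs <;> simp, ?_, ?_, ?_, ?_⟩
    · simp
    · simp
    · simp only [ite_mul, one_mul, zero_mul, sum_ite_eq', mem_range]
      simp only [Order.lt_add_one_iff, le_refl, if_true, pow_zero, mul_one]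
      push_cast
      nlinarith [show (0 : ℝ) ≤ (n₁ : ℝ) + n₂ by positivity]
    · intro y
      simp only [pow_zero, ite_mul, one_mul, zero_mul, sum_ite_eq', mem_range]
      simp only [Order.lt_add_one_iff, le_refl, if_true, Nat.sub_self, Matrix.one_apply]
      by_cases hy : y = 0
      · simp [hy, binMass]
      · have : 0 < (y : ℕ) := Nat.pos_of_ne_zero fun h => hy (Fin.ext h)
        rw [if_neg (Ne.symm hy), binMass_eq_zero _ this]
  | succ t ih =>
    obtain ⟨w, h0, h1, h2, h3, h4⟩ := ih
    set r : ℝ := (n₁ : ℝ) / ((n₁ : ℝ) + n₂) with hr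
    -- Expectation of `F` under the new weights by conditioning on the old `u`; all four remaining
    -- claims are instances for particular `F`.
    have step : ∀ F : ℕ → ℝ, ∑ v ∈ range (n₁ + n₂ + 1), (∑ u ∈ range (n₁ + n₂ + 1),
          w u * if v ≤ u then hyperMass n₁ n₂ v (u - v) else 0) * F v
        = ∑ u ∈ range (n₁ + n₂ + 1),
          w u * ∑ k ∈ antidiagonal u, hyperMass n₁ n₂ k.1 k.2 * F k.1 := by
      intro F
      simp only [sum_mul]
      rw [sum_comm]
      refine sum_congr rfl fun u hu => ?_
      simp only [mul_assoc, ← mul_sum]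
      rw [Nat.sum_antidiagonal_eq_sum_range_succ (fun i j => hyperMass n₁ n₂ i j * F i)]
      simp only [ite_mul, zero_mul]
      rw [← sum_filter]
      congr 2
      ext v
      simp at hu ⊢
      omega
    have hle : ∀ u ∈ range (n₁ + n₂ + 1), u ≤ n₁ + n₂ := fun u hu =>
      Nat.lt_succ_iff.mp (mem_range.mp hu)
    refine ⟨fun v => ∑ u ∈ range (n₁ + n₂ + 1),
      w u * if v ≤ u then hyperMass n₁ n₂ v (u - v) else 0, ?_, ?_, ?_, ?_, ?_⟩
    · intro v
      refine sum_nonneg fun u _ => mul_nonneg (h0 u) ?_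
      split_ifs
      exacts [hyperMass_nonneg _ _ _ _, le_rfl]
    · have := step (fun _ => 1)
      simp only [mul_one] at this
      rw [this, ← h1]
      exact sum_congr rfl fun u hu => by rw [sum_hyperMass (hle u hu), mul_one]
    · rw [step (fun v => (v : ℝ)),
        sum_congr rfl fun u hu => by rw [sum_hyperMass_mul_id (hle u hu) hn₁], pow_succ,
        ← mul_assoc, ← h2, sum_mul]
      exact sum_congr rfl fun u _ => by ring
    · rw [step (fun v => (v : ℝ) * ((v : ℝ) - 1))]
      calc _ ≤ ∑ u ∈ range (n₁ + n₂ + 1), w u * (r ^ 2 * (u * ((u : ℝ) - 1))) :=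
            sum_le_sum fun u hu => mul_le_mul_of_nonneg_left
              (sum_hyperMass_mul_descFactorial_le (hle u hu) hn₁ hn₂) (h0 u)
        _ = r ^ 2 * ∑ u ∈ range (n₁ + n₂ + 1), w u * (u * ((u : ℝ) - 1)) := by
            rw [mul_sum]; exact sum_congr rfl fun u _ => by ring
        _ ≤ r ^ 2 * (((n₁ : ℝ) + n₂) * r ^ t) ^ 2 :=
            mul_le_mul_of_nonneg_left h3 (sq_nonneg _)
        _ = _ := by ring
    · intro y
      rw [step (fun v => binMass p (n₁ + n₂ - v) y), pow_succ, Matrix.mul_apply]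
      simp only [h4, sum_mul]
      rw [sum_comm]
      refine sum_congr rfl fun u hu => ?_
      rw [← sum_binMass_mul_binKernel hp0 hp (hle u hu), mul_sum]
      exact sum_congr rfl fun x _ => by ring

/-! ### Total variation as a one-sided Kolmogorov distance. -/

lemma sum_filter_le_half_sum_abs {ι : Type*} (s : Finset ι) (d : ι → ℝ) (hd : ∑ y ∈ s, d y = 0)
    (P : ι → Prop) [DecidablePred P] :
    ∑ y ∈ s.filter P, d y ≤ (1 / 2) * ∑ y ∈ s, |d y| := by
  have h1 := sum_filter_add_sum_filter_not s P d
  have h2 := sum_filter_add_sum_filter_not s P (fun y => |d y|)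
  have h3 : ∑ y ∈ s.filter P, d y ≤ ∑ y ∈ s.filter P, |d y| :=
    sum_le_sum fun y _ => le_abs_self _
  have h4 : -∑ y ∈ s.filter (¬ P ·), d y ≤ ∑ y ∈ s.filter (¬ P ·), |d y| := by
    rw [← sum_neg_distrib]
    exact sum_le_sum fun y _ => neg_le_abs _
  linarith

/-- If the likelihood ratio of two mass functions is monotone, then the total variation distance is
attained on an initial segment. -/
lemma exists_half_sum_abs_eq (n : ℕ) (d ν R : ℕ → ℝ) (hν : ∀ y, 0 ≤ ν y) (hR : Antitone R)
    (hdR : ∀ y, d y = ν y * R y - ν y) (hd : ∑ y ∈ range n, d y = 0) :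
    ∃ k : ℕ, (1 / 2) * ∑ y ∈ range n, |d y| = ∑ y ∈ (range n).filter (· < k), d y := by
  obtain ⟨k, hk1, hk2⟩ : ∃ k : ℕ, (∀ y < k, 1 ≤ R y) ∧ ∀ y < n, k ≤ y → R y ≤ 1 := by
    -- The cut is the first place where the ratio drops below `1`, or the whole range if it never
    -- does.
    by_cases h : ∃ y, R y < 1
    · refine ⟨Nat.find h, fun y hy => not_lt.mp (Nat.find_min h hy), fun y _ hy => ?_⟩
      exact (hR hy).trans (Nat.find_spec h).le
    · push Not at h
      exact ⟨n, fun y _ => h y, fun y hy hy' => absurd hy (not_lt.mpr hy')⟩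
  refine ⟨k, ?_⟩
  have h1 := sum_filter_add_sum_filter_not (range n) (· < k) d
  have h2 := sum_filter_add_sum_filter_not (range n) (· < k) (fun y => |d y|)
  have h3 : ∑ y ∈ (range n).filter (· < k), |d y| = ∑ y ∈ (range n).filter (· < k), d y :=
    sum_congr rfl fun y hy => abs_of_nonneg <| by
      rw [hdR]
      nlinarith [hk1 y (mem_filter.mp hy).2, hν y]
  have h4 : ∑ y ∈ (range n).filter (¬ · < k), |d y| = -∑ y ∈ (range n).filter (¬ · < k), d y := by
    rw [← sum_neg_distrib]
    refine sum_congr rfl fun y hy => abs_of_nonpos ?_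
    obtain ⟨hy1, hy2⟩ := mem_filter.mp hy
    rw [hdR]
    nlinarith [hk2 y (mem_range.mp hy1) (not_lt.mp hy2), hν y]
  linarith

/-- The mixture `∑ u, w u Bin(n - u, p)` of binomial mass functions. -/
noncomputable def mixMass (p : ℝ) (n : ℕ) (w : ℕ → ℝ) (y : ℕ) : ℝ :=
  ∑ u ∈ range (n + 1), w u * binMass p (n - u) y

lemma mixMass_nonneg {p : ℝ} (h0 : 0 ≤ p) (h1 : p < 1) (n : ℕ) {w : ℕ → ℝ} (hw : ∀ u, 0 ≤ w u)
    (y : ℕ) : 0 ≤ mixMass p n w y :=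
  sum_nonneg fun u _ => mul_nonneg (hw u) (binMass_nonneg h0 h1 _ _)

lemma sum_mixMass {p : ℝ} (h1 : p < 1) (n : ℕ) {w : ℕ → ℝ} (hw : ∑ u ∈ range (n + 1), w u = 1) :
    ∑ y ∈ range (n + 1), mixMass p n w y = 1 := by
  simp only [mixMass]
  rw [sum_comm, ← hw]
  refine sum_congr rfl fun u _ => ?_
  rw [← mul_sum, sum_binMass h1 (Nat.sub_le _ _), mul_one]

lemma mixMass_single (p : ℝ) (n : ℕ) (y : ℕ) :
    mixMass p n (fun u => if u = 0 then 1 else 0) y = binMass p n y := by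
  simp [mixMass]

/-- `R` is a nonnegative combination of the ratios from `binMass_sub_eq`, each decreasing because
`choose (n - y) u` is. -/
lemma exists_antitone_mixMass_eq {p : ℝ} (h1 : p < 1) (n : ℕ) {w : ℕ → ℝ} (hw : ∀ u, 0 ≤ w u) :
    ∃ R : ℕ → ℝ, Antitone R ∧ ∀ y, mixMass p n w y = binMass p n y * R y := by
  have hq : 0 < 1 - p := by linarith
  refine ⟨fun y => ∑ u ∈ range (n + 1),
    w u * (((n - y).choose u : ℝ) / ((n.choose u : ℝ) * (1 - p) ^ u)), ?_, fun y => ?_⟩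
  · intro y y' h
    refine sum_le_sum fun u _ => mul_le_mul_of_nonneg_left ?_ (hw u)
    gcongr
  · rw [mixMass, mul_sum]
    refine sum_congr rfl fun u hu => ?_
    rw [binMass_sub_eq h1 (Nat.lt_succ_iff.mp (mem_range.mp hu))]
    ring

/-- The law on `ℝ` putting mass `m y` at `(y - b) / s` for `y ≤ n`. -/
noncomputable def scaledLaw (n : ℕ) (m : ℕ → ℝ) (b s : ℝ) : Measure ℝ :=
  ∑ y ∈ range (n + 1), ENNReal.ofReal (m y) • Measure.dirac (((y : ℝ) - b) / s)

lemma isProbabilityMeasure_scaledLaw {n : ℕ} {m : ℕ → ℝ} (h0 : ∀ y, 0 ≤ m y)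
    (h1 : ∑ y ∈ range (n + 1), m y = 1) (b s : ℝ) : IsProbabilityMeasure (scaledLaw n m b s) := by
  constructor
  simp only [scaledLaw, Measure.coe_finsetSum, Finset.sum_apply, Measure.smul_apply,
    measure_univ, smul_eq_mul, mul_one]
  rw [← ENNReal.ofReal_sum_of_nonneg fun y _ => h0 y, h1, ENNReal.ofReal_one]

lemma scaledLaw_real_Iic {n : ℕ} {m : ℕ → ℝ} (h0 : ∀ y, 0 ≤ m y) (b s x : ℝ) :
    (scaledLaw n m b s).real (Set.Iic x)
      = ∑ y ∈ (range (n + 1)).filter (fun y : ℕ => ((y : ℝ) - b) / s ≤ x), m y := by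
  have : (scaledLaw n m b s) (Set.Iic x)
      = ENNReal.ofReal (∑ y ∈ (range (n + 1)).filter (fun y : ℕ => ((y : ℝ) - b) / s ≤ x), m y) := by
    rw [ENNReal.ofReal_sum_of_nonneg fun y _ => h0 y, sum_filter]
    simp only [scaledLaw, Measure.coe_finsetSum, Finset.sum_apply, Measure.smul_apply,
      smul_eq_mul]
    refine sum_congr rfl fun y _ => ?_
    rw [Measure.dirac_apply' _ measurableSet_Iic]
    by_cases h : ((y : ℝ) - b) / s ≤ x <;> simp [h]
  rw [Measure.real, this, ENNReal.toReal_ofReal (sum_nonneg fun y _ => h0 y)]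

lemma charFun_scaledLaw {n : ℕ} {m : ℕ → ℝ} (h0 : ∀ y, 0 ≤ m y) (b s ξ : ℝ) :
    charFun (scaledLaw n m b s) ξ
      = ∑ y ∈ range (n + 1), (m y : ℂ) * Complex.exp (ξ * (((y : ℝ) - b) / s : ℝ) * Complex.I) := by
  rw [charFun_apply_real, scaledLaw, integral_finsetSum_measure]
  · refine sum_congr rfl fun y _ => ?_
    rw [integral_smul_measure, integral_dirac, ENNReal.toReal_ofReal (h0 y), Complex.real_smul]
  · intro y _
    refine Integrable.smul_measure ?_ ENNReal.ofReal_ne_top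
    exact integrable_dirac (by simp)

/-- Total variation distance is realized as a Kolmogorov distance of the scaled laws. -/
lemma half_sum_abs_mixMass_sub {p : ℝ} (h0 : 0 ≤ p) (h1 : p < 1) (n : ℕ) {w : ℕ → ℝ}
    (hw : ∀ u, 0 ≤ w u) (hw1 : ∑ u ∈ range (n + 1), w u = 1) (b : ℝ) {s : ℝ} (hs : 0 < s) :
    (∀ x, (scaledLaw n (mixMass p n w) b s).real (Set.Iic x)
        - (scaledLaw n (binMass p n) b s).real (Set.Iic x)
      ≤ (1 / 2) * ∑ y ∈ range (n + 1), |mixMass p n w y - binMass p n y|) ∧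
    ∃ x, (1 / 2) * ∑ y ∈ range (n + 1), |mixMass p n w y - binMass p n y|
      = (scaledLaw n (mixMass p n w) b s).real (Set.Iic x)
        - (scaledLaw n (binMass p n) b s).real (Set.Iic x) := by
  have hd : ∑ y ∈ range (n + 1), (mixMass p n w y - binMass p n y) = 0 := by
    rw [sum_sub_distrib, sum_mixMass h1 n hw1, sum_binMass h1 le_rfl, sub_self]
  simp only [scaledLaw_real_Iic (mixMass_nonneg h0 h1 n hw), scaledLaw_real_Iic
    (binMass_nonneg h0 h1 n), ← sum_sub_distrib]
  refine ⟨fun x => sum_filter_le_half_sum_abs _ _ hd _, ?_⟩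
  obtain ⟨R, hR, hR'⟩ := exists_antitone_mixMass_eq h1 n hw
  obtain ⟨k, hk⟩ := exists_half_sum_abs_eq (n + 1) (fun y => mixMass p n w y - binMass p n y)
    (binMass p n) R (binMass_nonneg h0 h1 n) hR (fun y => by rw [hR']) hd
  -- For integers `y < k` means `y ≤ k - 1`; the subtraction is real, so `k = 0` gives the empty
  -- segment.
  refine ⟨((k : ℝ) - 1 - b) / s, ?_⟩
  rw [hk]
  refine sum_congr (filter_congr fun y _ => ?_) fun _ _ => rfl
  rw [div_le_div_iff_of_pos_right hs, sub_le_sub_iff_right, le_sub_iff_add_le]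
  norm_cast

lemma dTV_eq {n₁ n₂ : ℕ} {p : unitInterval} (hp : (p : ℝ) < 1) {t : ℕ} {w : ℕ → ℝ}
    (hw : ∀ y : Fin (n₁ + n₂ + 1), (binKernel n₁ n₂ p ^ t) 0 y
        = ∑ u ∈ range (n₁ + n₂ + 1), w u * binMass p (n₁ + n₂ - u) y) :
    dTV n₁ n₂ p t = (1 / 2) * ∑ y ∈ range (n₁ + n₂ + 1),
      |mixMass p (n₁ + n₂) w y - binMass p (n₁ + n₂) y| := by
  rw [dTV, tvDist, ← Fin.sum_univ_eq_sum_range (fun y =>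
    |mixMass p (n₁ + n₂) w y - binMass p (n₁ + n₂) y|)]
  congr 1
  refine sum_congr rfl fun y _ => ?_
  rw [hw, binMarginal_eq, binomialMass_eq_binMass _ _ hp, mixMass]

/-! ### Characteristic functions and the central limit theorem. -/

lemma sum_binMass_mul_pow {p : ℝ} (hp : p < 1) {j n : ℕ} (h : j ≤ n) (z : ℂ) :
    ∑ y ∈ range (n + 1), (binMass p j y : ℂ) * z ^ y = ((1 - p : ℝ) + p * z) ^ j := by
  have h1 : ∑ y ∈ range (j + 1), (binMass p j y : ℂ) * z ^ y = ((1 - p : ℝ) + p * z) ^ j := by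
    rw [add_comm ((1 - p : ℝ) : ℂ), add_pow]
    refine sum_congr rfl fun y _ => ?_
    rw [binMass_eq p hp]
    push_cast
    ring
  rw [← h1]
  symm
  refine sum_subset (by intro x; simp; omega) fun x _ hx => ?_
  rw [binMass_eq_zero p (by simpa using hx)]
  simp

/-- The characteristic function at `δ` of a centred Bernoulli variable. -/
noncomputable def bernoulliCharFun (p δ : ℝ) : ℂ :=
  (1 - p : ℝ) * Complex.exp ((-(p * δ) : ℝ) * Complex.I)
    + p * Complex.exp (((1 - p) * δ : ℝ) * Complex.I)

lemma bernoulliCharFun_eq (p δ : ℝ) :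
    bernoulliCharFun p δ
      = ((1 - p : ℝ) + p * Complex.exp (δ * Complex.I)) * Complex.exp (-(p * δ) * Complex.I) := by
  rw [bernoulliCharFun, add_mul, mul_assoc (p : ℂ), ← Complex.exp_add]
  push_cast
  ring_nf

lemma norm_bernoulliCharFun_le {p : ℝ} (h0 : 0 ≤ p) (h1 : p ≤ 1) (δ : ℝ) :
    ‖bernoulliCharFun p δ‖ ≤ 1 := by
  refine (norm_add_le _ _).trans ?_
  rw [norm_mul, norm_mul, Complex.norm_exp_ofReal_mul_I, Complex.norm_exp_ofReal_mul_I,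
    Complex.norm_real, Complex.norm_real, Real.norm_of_nonneg h0,
    Real.norm_of_nonneg (by linarith)]
  linarith

/-- Each component has mean `(n - u)p` but is centred at `np`, which leaves the phase of drift
`-pu`. -/
lemma charFun_scaledLaw_mixMass {p : ℝ} (h0 : 0 ≤ p) (h1 : p < 1) (n : ℕ) {w : ℕ → ℝ}
    (hw : ∀ u, 0 ≤ w u) (s ξ : ℝ) :
    charFun (scaledLaw n (mixMass p n w) (n * p) s) ξ
      = ∑ u ∈ range (n + 1), (w u : ℂ) * (bernoulliCharFun p (ξ / s) ^ (n - u)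
          * Complex.exp ((-(p * (ξ / s)) * u : ℝ) * Complex.I)) := by
  rw [charFun_scaledLaw (mixMass_nonneg h0 h1 n hw)]
  set δ := ξ / s with hδ
  have e : ∀ y : ℕ, (mixMass p n w y : ℂ)
        * Complex.exp (ξ * (((y : ℝ) - n * p) / s : ℝ) * Complex.I)
      = ∑ u ∈ range (n + 1), (w u : ℂ) * Complex.exp ((-(p * δ) * n : ℝ) * Complex.I)
        * ((binMass p (n - u) y : ℂ) * Complex.exp (δ * Complex.I) ^ y) := by
    intro y
    have : Complex.exp (ξ * (((y : ℝ) - n * p) / s : ℝ) * Complex.I)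
        = Complex.exp ((-(p * δ) * n : ℝ) * Complex.I) * Complex.exp (δ * Complex.I) ^ y := by
      rw [← Complex.exp_nat_mul, ← Complex.exp_add, hδ]
      congr 1
      push_cast
      ring
    rw [this, mixMass]
    push_cast
    rw [sum_mul]
    exact sum_congr rfl fun u _ => by ring
  rw [sum_congr rfl fun y _ => e y, sum_comm]
  refine sum_congr rfl fun u hu => ?_
  obtain ⟨k, hk⟩ := Nat.exists_eq_add_of_le (Nat.lt_succ_iff.mp (mem_range.mp hu))
  rw [← mul_sum, sum_binMass_mul_pow h1 (Nat.sub_le _ _), bernoulliCharFun_eq, mul_pow,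
    ← Complex.exp_nat_mul, mul_assoc, mul_assoc, ← Complex.exp_add, mul_comm (Complex.exp _)]
  congr 3
  rw [hk, Nat.add_sub_cancel_left]
  push_cast
  ring

lemma norm_pow_sub_pow_le {a b : ℂ} (ha : ‖a‖ ≤ 1) (hb : ‖b‖ ≤ 1) (n : ℕ) :
    ‖a ^ n - b ^ n‖ ≤ n * ‖a - b‖ := by
  induction n with
  | zero => simp
  | succ n ih =>
    have h1 : ‖a ^ n‖ ≤ 1 := by rw [norm_pow]; exact pow_le_one₀ (norm_nonneg _) ha
    calc ‖a ^ (n + 1) - b ^ (n + 1)‖ = ‖a ^ n * (a - b) + (a ^ n - b ^ n) * b‖ := by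
          congr 1; ring
      _ ≤ ‖a ^ n‖ * ‖a - b‖ + ‖a ^ n - b ^ n‖ * ‖b‖ := by
          refine (norm_add_le _ _).trans ?_
          rw [norm_mul, norm_mul]
      _ ≤ 1 * ‖a - b‖ + (n * ‖a - b‖) * 1 := by gcongr
      _ = _ := by push_cast; ring

lemma norm_exp_mul_I_sub_exp_mul_I_le (x y : ℝ) :
    ‖Complex.exp (x * Complex.I) - Complex.exp (y * Complex.I)‖ ≤ |x - y| := by
  have : Complex.exp (x * Complex.I) - Complex.exp (y * Complex.I)
      = Complex.exp (y * Complex.I) * (Complex.exp (Complex.I * (x - y : ℝ)) - 1) := by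
    rw [mul_sub, ← Complex.exp_add, mul_one]
    push_cast
    ring_nf
  rw [this, norm_mul, Complex.norm_exp_ofReal_mul_I, one_mul]
  exact Real.norm_exp_I_mul_ofReal_sub_one_le

/-- The moment hypotheses give variance at most `M² + (1 - 2M)M + M² = M`; Jensen's inequality
bounds the mean deviation. -/
lemma sum_mul_abs_sub_le_sqrt {n : ℕ} {w : ℕ → ℝ} {M : ℝ} (hw : ∀ u, 0 ≤ w u)
    (hw1 : ∑ u ∈ range (n + 1), w u = 1) (hM : ∑ u ∈ range (n + 1), w u * (u : ℝ) = M)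
    (hM2 : ∑ u ∈ range (n + 1), w u * (u * ((u : ℝ) - 1)) ≤ M ^ 2) :
    ∑ u ∈ range (n + 1), w u * |(u : ℝ) - M| ≤ √M := by
  refine Real.le_sqrt_of_sq_le ?_
  refine (Real.pow_arith_mean_le_arith_mean_pow _ _ _ (fun u _ => hw u) hw1
    (fun u _ => abs_nonneg _) 2).trans ?_
  have : ∑ u ∈ range (n + 1), w u * |(u : ℝ) - M| ^ 2
      = ∑ u ∈ range (n + 1), w u * (u * ((u : ℝ) - 1))
        + (1 - 2 * M) * ∑ u ∈ range (n + 1), w u * (u : ℝ)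
        + M ^ 2 * ∑ u ∈ range (n + 1), w u := by
    rw [mul_sum, mul_sum, ← sum_add_distrib, ← sum_add_distrib]
    exact sum_congr rfl fun u _ => by rw [sq_abs]; ring
  rw [this, hM, hw1]
  linarith

/-- Replaces the random `u` by its mean `M`. Changing `ψ^(n-u)` to `ψ^n` costs `u‖ψ - 1‖`, and
changing the phase costs `|β||u - M|`. -/
lemma norm_sum_mul_pow_sub_le {n : ℕ} {w : ℕ → ℝ} {M : ℝ} (hw : ∀ u, 0 ≤ w u)
    (hw1 : ∑ u ∈ range (n + 1), w u = 1) (hM : ∑ u ∈ range (n + 1), w u * (u : ℝ) = M)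
    (hM2 : ∑ u ∈ range (n + 1), w u * (u * ((u : ℝ) - 1)) ≤ M ^ 2)
    {ψ : ℂ} (hψ : ‖ψ‖ ≤ 1) (β : ℝ) :
    ‖∑ u ∈ range (n + 1), (w u : ℂ) * (ψ ^ (n - u) * Complex.exp ((β * u : ℝ) * Complex.I))
        - ψ ^ n * Complex.exp ((β * M : ℝ) * Complex.I)‖
      ≤ M * ‖ψ - 1‖ + |β| * √M := by
  have hw1' : ∑ u ∈ range (n + 1), (w u : ℂ) = 1 := by exact_mod_cast hw1
  have e : ∑ u ∈ range (n + 1), (w u : ℂ)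
          * (ψ ^ (n - u) * Complex.exp ((β * u : ℝ) * Complex.I))
        - ψ ^ n * Complex.exp ((β * M : ℝ) * Complex.I)
      = ∑ u ∈ range (n + 1), (w u : ℂ) * (ψ ^ (n - u) * Complex.exp ((β * u : ℝ) * Complex.I)
        - ψ ^ n * Complex.exp ((β * M : ℝ) * Complex.I)) := by
    simp only [mul_sub, sum_sub_distrib]
    rw [← sum_mul, hw1', one_mul]
  have term : ∀ u ∈ range (n + 1),
      ‖(w u : ℂ) * (ψ ^ (n - u) * Complex.exp ((β * u : ℝ) * Complex.I)
        - ψ ^ n * Complex.exp ((β * M : ℝ) * Complex.I))‖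
      ≤ w u * (u : ℝ) * ‖ψ - 1‖ + |β| * (w u * |(u : ℝ) - M|) := by
    intro u hu
    obtain ⟨k, hk⟩ := Nat.exists_eq_add_of_le (Nat.lt_succ_iff.mp (mem_range.mp hu))
    have h1 : ‖ψ ^ k‖ ≤ 1 := by rw [norm_pow]; exact pow_le_one₀ (norm_nonneg _) hψ
    have h2 : ‖ψ ^ n‖ ≤ 1 := by rw [norm_pow]; exact pow_le_one₀ (norm_nonneg _) hψ
    have h3 := norm_pow_sub_pow_le (a := 1) (by simp) hψ u
    rw [one_pow, norm_sub_rev 1 ψ] at h3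
    have h4 := norm_exp_mul_I_sub_exp_mul_I_le (β * u) (β * M)
    rw [← mul_sub, abs_mul] at h4
    have h5 : ψ ^ (n - u) * Complex.exp ((β * u : ℝ) * Complex.I)
          - ψ ^ n * Complex.exp ((β * M : ℝ) * Complex.I)
        = ψ ^ k * (1 - ψ ^ u) * Complex.exp ((β * u : ℝ) * Complex.I)
          + ψ ^ n * (Complex.exp ((β * u : ℝ) * Complex.I)
            - Complex.exp ((β * M : ℝ) * Complex.I)) := by
      rw [hk, Nat.add_sub_cancel_left]; ring
    have h6 : ‖ψ ^ (n - u) * Complex.exp ((β * u : ℝ) * Complex.I)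
          - ψ ^ n * Complex.exp ((β * M : ℝ) * Complex.I)‖
        ≤ u * ‖ψ - 1‖ + |β| * |(u : ℝ) - M| := by
      rw [h5]
      refine (norm_add_le _ _).trans (add_le_add ?_ ?_)
      · rw [norm_mul, norm_mul, Complex.norm_exp_ofReal_mul_I, mul_one]
        exact (mul_le_of_le_one_left (norm_nonneg _) h1).trans h3
      · rw [norm_mul]
        exact (mul_le_of_le_one_left (norm_nonneg _) h2).trans h4
    rw [norm_mul, Complex.norm_real, Real.norm_of_nonneg (hw u)]
    refine (mul_le_mul_of_nonneg_left h6 (hw u)).trans_eq (by ring)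
  rw [e]
  refine (norm_sum_le_of_le _ term).trans ?_
  rw [sum_add_distrib, ← sum_mul, hM, ← mul_sum]
  gcongr
  exact sum_mul_abs_sub_le_sqrt hw hw1 hM hM2

/-- The constant `3` bounds the factor `exp |x| ≤ e` in the cubic remainder. -/
lemma norm_exp_mul_I_sub_taylor_le {x : ℝ} (hx : |x| ≤ 1) :
    ‖Complex.exp (x * Complex.I) - (1 + x * Complex.I - x ^ 2 / 2)‖ ≤ 3 * |x| ^ 3 := by
  have h := Complex.norm_exp_sub_sum_le_norm_mul_exp (x * Complex.I) 3
  have e : ∑ m ∈ range 3, ((x : ℂ) * Complex.I) ^ m / (m.factorial : ℂ)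
      = 1 + x * Complex.I - x ^ 2 / 2 := by
    simp [sum_range_succ, mul_pow, Nat.factorial]
    ring
  rw [e, norm_mul, Complex.norm_I, mul_one, Complex.norm_real, Real.norm_eq_abs] at h
  refine h.trans ?_
  rw [mul_comm]
  gcongr
  refine (Real.exp_le_exp.mpr hx).trans ?_
  linarith [Real.exp_one_lt_d9]

/-- Centring cancels the linear terms. The error keeps the factor `p(1-p)`, which makes the limit
theorem uniform in `p`. -/
lemma norm_bernoulliCharFun_sub_le {p δ : ℝ} (h0 : 0 ≤ p) (h1 : p ≤ 1) (hδ : |δ| ≤ 1) :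
    ‖bernoulliCharFun p δ - (1 - (p * (1 - p) * δ ^ 2 / 2 : ℝ))‖
      ≤ 3 * (p * (1 - p)) * |δ| ^ 3 := by
  have hq : 0 ≤ 1 - p := by linarith
  have b1 : |-(p * δ)| = p * |δ| := by rw [abs_neg, abs_mul, abs_of_nonneg h0]
  have b2 : |(1 - p) * δ| = (1 - p) * |δ| := by rw [abs_mul, abs_of_nonneg hq]
  have t1 := norm_exp_mul_I_sub_taylor_le (x := -(p * δ))
    (by rw [b1]; nlinarith [abs_nonneg δ])
  have t2 := norm_exp_mul_I_sub_taylor_le (x := (1 - p) * δ)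
    (by rw [b2]; nlinarith [abs_nonneg δ])
  rw [b1] at t1
  rw [b2] at t2
  have e : bernoulliCharFun p δ - (1 - (p * (1 - p) * δ ^ 2 / 2 : ℝ))
      = (1 - p : ℝ) * (Complex.exp ((-(p * δ) : ℝ) * Complex.I)
          - (1 + (-(p * δ) : ℝ) * Complex.I - ((-(p * δ) : ℝ) : ℂ) ^ 2 / 2))
        + p * (Complex.exp (((1 - p) * δ : ℝ) * Complex.I)
          - (1 + ((1 - p) * δ : ℝ) * Complex.I - (((1 - p) * δ : ℝ) : ℂ) ^ 2 / 2)) := by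
    rw [bernoulliCharFun]
    push_cast
    ring
  rw [e]
  refine (norm_add_le _ _).trans ?_
  rw [norm_mul, norm_mul, Complex.norm_real, Complex.norm_real, Real.norm_of_nonneg h0,
    Real.norm_of_nonneg hq]
  calc _ ≤ (1 - p) * (3 * (p * |δ|) ^ 3) + p * (3 * ((1 - p) * |δ|) ^ 3) := by gcongr
    _ = 3 * (p * (1 - p)) * |δ| ^ 3 * (p ^ 2 + (1 - p) ^ 2) := by ring
    _ ≤ 3 * (p * (1 - p)) * |δ| ^ 3 * 1 := by
        gcongr
        nlinarith
    _ = _ := mul_one _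

/-- The larger of `p` and `1 - p` is at least `1/2`, so `p(1-p) ≥ min(p, 1-p)/2`. -/
lemma tendsto_sqrt_variance {n : ℕ → ℕ} {p : ℕ → ℝ} (hp : ∀ N, 0 < p N ∧ p N < 1)
    (hlim : Tendsto (fun N => (n N : ℝ) * min (p N) (1 - p N)) atTop atTop) :
    Tendsto (fun N => √(n N * p N * (1 - p N))) atTop atTop := by
  refine Real.tendsto_sqrt_atTop.comp ?_
  refine tendsto_atTop_mono (fun N => ?_) (hlim.const_mul_atTop (show (0 : ℝ) < 1 / 2 by norm_num))
  obtain ⟨h0, h1⟩ := hp N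
  have hn : (0 : ℝ) ≤ n N := Nat.cast_nonneg _
  rw [mul_left_comm, mul_assoc]
  refine mul_le_mul_of_nonneg_left ?_ hn
  rcases le_total (p N) (1 - p N) with h | h
  · rw [min_eq_left h]; nlinarith
  · rw [min_eq_right h]; nlinarith

lemma tendsto_natCast_atTop_of_mul_min {n : ℕ → ℕ} {p : ℕ → ℝ} (hp : ∀ N, 0 < p N ∧ p N < 1)
    (hlim : Tendsto (fun N => (n N : ℝ) * min (p N) (1 - p N)) atTop atTop) :
    Tendsto (fun N => (n N : ℝ)) atTop atTop :=
  tendsto_atTop_mono (fun N => mul_le_of_le_one_right (Nat.cast_nonneg _)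
    ((min_le_left _ _).trans (hp N).2.le)) hlim

/-- With `δ = ξ/σ`, `n p(1-p) δ² = ξ²` absorbs two powers of the cubic error, leaving one factor
`|δ|` that tends to zero. -/
lemma mul_norm_bernoulliCharFun_sub_le {n p σ ξ : ℝ} (hn : 0 < n) (h0 : 0 < p) (h1 : p < 1)
    (hσ2 : σ ^ 2 = n * p * (1 - p)) (hδ : |ξ / σ| ≤ 1) :
    n * ‖bernoulliCharFun p (ξ / σ) - (1 - (ξ ^ 2 / 2 / n : ℝ))‖ ≤ 3 * ξ ^ 2 * |ξ / σ| := by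
  have hq : 0 < 1 - p := by linarith
  have h := norm_bernoulliCharFun_sub_le h0.le h1.le hδ
  have e : p * (1 - p) * (ξ / σ) ^ 2 = ξ ^ 2 / n := by
    rw [div_pow, hσ2]
    field_simp
  rw [e, div_right_comm] at h
  calc _ ≤ n * (3 * (p * (1 - p)) * |ξ / σ| ^ 3) := by gcongr
    _ = 3 * (n * (p * (1 - p) * |ξ / σ| ^ 2)) * |ξ / σ| := by ring
    _ = _ := by
      rw [sq_abs, e]
      field_simp

/-- The limit is written as the `n`-th power of `exp(-x)` with `x = ξ²/(2n)`; on the unit disc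
`n`-th powers are `n`-Lipschitz, so bases are compared to second order. -/
lemma tendsto_bernoulliCharFun_pow {n : ℕ → ℕ} {p : ℕ → ℝ} (hp : ∀ N, 0 < p N ∧ p N < 1)
    (hlim : Tendsto (fun N => (n N : ℝ) * min (p N) (1 - p N)) atTop atTop) (ξ : ℝ) :
    Tendsto (fun N => bernoulliCharFun (p N) (ξ / √(n N * p N * (1 - p N))) ^ n N) atTop
      (𝓝 (Complex.exp (-(ξ ^ 2 / 2) : ℝ))) := by
  have hσ := tendsto_sqrt_variance hp hlim
  have hn := tendsto_natCast_atTop_of_mul_min hp hlim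
  have hδ : Tendsto (fun N => |ξ / √(n N * p N * (1 - p N))|) atTop (𝓝 0) := by
    simpa using (hσ.const_div_atTop ξ).abs
  have hx : Tendsto (fun N => ξ ^ 2 / 2 / (n N : ℝ)) atTop (𝓝 0) := hn.const_div_atTop _
  rw [tendsto_iff_norm_sub_tendsto_zero]
  have hb : Tendsto (fun N => 3 * ξ ^ 2 * |ξ / √(n N * p N * (1 - p N))|
      + ξ ^ 2 / 2 * (ξ ^ 2 / 2 / (n N : ℝ))) atTop (𝓝 0) := by
    simpa using (hδ.const_mul (3 * ξ ^ 2)).add (hx.const_mul (ξ ^ 2 / 2))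
  refine squeeze_zero' (Eventually.of_forall fun _ => norm_nonneg _) ?_ hb
  filter_upwards [hδ.eventually_le_const one_pos, hx.eventually_le_const one_pos,
    hσ.eventually_gt_atTop 0, hn.eventually_gt_atTop 0] with N e1 e2 e3 e4
  obtain ⟨h0, h1⟩ := hp N
  have hq : 0 < 1 - p N := by linarith
  set x := ξ ^ 2 / 2 / (n N : ℝ) with hxdef
  have hx0 : 0 ≤ x := by positivity
  set ψ := bernoulliCharFun (p N) (ξ / √(n N * p N * (1 - p N)))
  have key := mul_norm_bernoulliCharFun_sub_le (ξ := ξ) e4 h0 h1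
    (Real.sq_sqrt (by positivity)) e1
  have hexp : Complex.exp (-(ξ ^ 2 / 2) : ℝ) = Complex.exp ((-x : ℝ) : ℂ) ^ n N := by
    rw [← Complex.exp_nat_mul]
    congr 1
    rw [hxdef]
    push_cast
    have : (n N : ℂ) ≠ 0 := by exact_mod_cast e4.ne'
    field_simp
  have hexp1 : ‖Complex.exp ((-x : ℝ) : ℂ)‖ ≤ 1 := by
    rw [Complex.norm_exp_ofReal]
    exact Real.exp_le_one_iff.mpr (by linarith)
  have hexp2 : ‖Complex.exp ((-x : ℝ) : ℂ) - (1 - (x : ℝ))‖ ≤ x ^ 2 := by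
    have := Complex.norm_exp_sub_one_sub_id_le (x := ((-x : ℝ) : ℂ))
      (by rw [Complex.norm_real, Real.norm_eq_abs, abs_neg, abs_of_nonneg hx0]; exact e2)
    rw [Complex.norm_real, Real.norm_eq_abs, abs_neg, abs_of_nonneg hx0] at this
    refine le_of_eq_of_le ?_ this
    congr 1
    push_cast
    ring
  rw [hexp]
  refine (norm_pow_sub_pow_le (norm_bernoulliCharFun_le h0.le h1.le _) hexp1 _).trans ?_
  calc (n N : ℝ) * ‖ψ - Complex.exp ((-x : ℝ) : ℂ)‖
      ≤ n N * (‖ψ - (1 - (x : ℝ))‖ + ‖Complex.exp ((-x : ℝ) : ℂ) - (1 - (x : ℝ))‖) := by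
        gcongr
        rw [norm_sub_rev (Complex.exp _)]
        exact norm_sub_le_norm_sub_add_norm_sub _ _ _
    _ ≤ n N * ‖ψ - (1 - (x : ℝ))‖ + n N * x ^ 2 := by
        rw [mul_add]; gcongr
    _ ≤ 3 * ξ ^ 2 * |ξ / √(n N * p N * (1 - p N))| + n N * x ^ 2 := by gcongr
    _ = _ := by
        congr 1
        rw [hxdef]
        field_simp

/-- A triangular central limit theorem for mixtures of binomial laws, in terms of characteristic
functions. -/
theorem tendsto_charFun_scaledLaw_mixMass {n : ℕ → ℕ} {p : ℕ → ℝ} (hp : ∀ N, 0 < p N ∧ p N < 1)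
    (hlim : Tendsto (fun N => (n N : ℝ) * min (p N) (1 - p N)) atTop atTop)
    {w : ℕ → ℕ → ℝ} {M : ℕ → ℝ} (hw : ∀ N u, 0 ≤ w N u)
    (hw1 : ∀ N, ∑ u ∈ range (n N + 1), w N u = 1)
    (hM : ∀ N, ∑ u ∈ range (n N + 1), w N u * (u : ℝ) = M N)
    (hM2 : ∀ N, ∑ u ∈ range (n N + 1), w N u * (u * ((u : ℝ) - 1)) ≤ M N ^ 2)
    {a : ℝ} (ha : Tendsto (fun N => p N * M N / √(n N * p N * (1 - p N))) atTop (𝓝 a)) (ξ : ℝ) :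
    Tendsto (fun N => charFun (scaledLaw (n N) (mixMass (p N) (n N) (w N)) (n N * p N)
      (√(n N * p N * (1 - p N)))) ξ) atTop (𝓝 (charFun (gaussianReal (-a) 1) ξ)) := by
  have hσ := tendsto_sqrt_variance hp hlim
  have hn := tendsto_natCast_atTop_of_mul_min hp hlim
  set σ : ℕ → ℝ := fun N => √(n N * p N * (1 - p N)) with hσdef
  have hM0 : ∀ N, 0 ≤ M N := fun N => by
    rw [← hM N]; exact sum_nonneg fun u _ => mul_nonneg (hw N u) (Nat.cast_nonneg _)
  have hδ : Tendsto (fun N => |ξ / σ N|) atTop (𝓝 0) := by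
    simpa using (hσ.const_div_atTop ξ).abs
  -- Both errors of `norm_sum_mul_pow_sub_le` are bounded through this quantity `pM/σ²`.
  have hg : Tendsto (fun N => p N * M N / σ N * (1 / σ N)) atTop (𝓝 0) := by
    simpa using ha.mul (hσ.const_div_atTop 1)
  have hmain : Tendsto (fun N => bernoulliCharFun (p N) (ξ / σ N) ^ n N
      * Complex.exp ((-(p N * (ξ / σ N)) * M N : ℝ) * Complex.I)) atTop
      (𝓝 (charFun (gaussianReal (-a) 1) ξ)) := by
    have h1 : Tendsto (fun N => -(p N * (ξ / σ N)) * M N) atTop (𝓝 (-(ξ * a))) := by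
      refine (ha.const_mul ξ).neg.congr fun N => ?_
      simp only [hσdef]
      ring
    have h2 : Tendsto (fun N => Complex.exp ((-(p N * (ξ / σ N)) * M N : ℝ) * Complex.I)) atTop
        (𝓝 (Complex.exp ((-(ξ * a) : ℝ) * Complex.I))) :=
      ((by fun_prop : Continuous fun x : ℝ => Complex.exp (x * Complex.I)).tendsto _).comp h1
    convert (tendsto_bernoulliCharFun_pow hp hlim ξ).mul h2 using 2
    rw [charFun_gaussianReal, ← Complex.exp_add]
    congr 1
    push_cast
    ring
  have hdiff : Tendsto (fun N => charFun (scaledLaw (n N) (mixMass (p N) (n N) (w N)) (n N * p N)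
      (σ N)) ξ - bernoulliCharFun (p N) (ξ / σ N) ^ n N
      * Complex.exp ((-(p N * (ξ / σ N)) * M N : ℝ) * Complex.I)) atTop (𝓝 0) := by
    have hb : Tendsto (fun N => 4 * ξ ^ 2 * (p N * M N / σ N * (1 / σ N))
        + |ξ| * √(p N * M N / σ N * (1 / σ N))) atTop (𝓝 0) := by
      simpa using (hg.const_mul (4 * ξ ^ 2)).add (hg.sqrt.const_mul |ξ|)
    refine squeeze_zero_norm' ?_ hb
    filter_upwards [hδ.eventually_le_const one_pos, hσ.eventually_gt_atTop 0,
      hn.eventually_gt_atTop 0] with N e1 e3 e4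
    obtain ⟨h0, h1⟩ := hp N
    have hq : 0 < 1 - p N := by linarith
    have hσ2 : σ N ^ 2 = n N * p N * (1 - p N) := Real.sq_sqrt (by positivity)
    rw [charFun_scaledLaw_mixMass h0.le h1 _ (hw N)]
    refine (norm_sum_mul_pow_sub_le (hw N) (hw1 N) (hM N) (hM2 N)
      (norm_bernoulliCharFun_le h0.le h1.le _) _).trans (add_le_add ?_ ?_)
    · set ψ := bernoulliCharFun (p N) (ξ / σ N)
      have key := mul_norm_bernoulliCharFun_sub_le (ξ := ξ) e4 h0 h1 hσ2 e1
      -- The error `3ξ²|δ| ≤ 3ξ²` and the main term `ξ²/2` together stay below `4ξ²`.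
      have h2 : n N * ‖ψ - 1‖ ≤ 4 * ξ ^ 2 := by
        have h3 : ‖ψ - 1‖ ≤ ‖ψ - (1 - (ξ ^ 2 / 2 / n N : ℝ))‖ + ξ ^ 2 / 2 / n N := by
          have h5 : ψ - 1 = (ψ - (1 - (ξ ^ 2 / 2 / n N : ℝ))) + (-(ξ ^ 2 / 2 / n N) : ℝ) := by
            push_cast; ring
          rw [h5]
          refine (norm_add_le _ _).trans_eq ?_
          rw [Complex.norm_real, norm_neg, Real.norm_of_nonneg (by positivity)]
        have h4 : (n N : ℝ) * (ξ ^ 2 / 2 / n N) = ξ ^ 2 / 2 := by field_simp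
        have h6 := mul_le_mul_of_nonneg_left h3 e4.le
        rw [mul_add, h4] at h6
        nlinarith [sq_nonneg ξ]
      have h7 : M N * ‖ψ - 1‖
          = (p N * M N / σ N * (1 / σ N)) * (1 - p N) * (n N * ‖ψ - 1‖) := by
        have : p N * M N / σ N * (1 / σ N) = p N * M N / σ N ^ 2 := by field_simp
        rw [this, hσ2]
        field_simp
      rw [h7]
      have h8 : 0 ≤ p N * M N / σ N * (1 / σ N) := by have := hM0 N; positivity
      calc _ ≤ (p N * M N / σ N * (1 / σ N)) * 1 * (4 * ξ ^ 2) := by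
            gcongr
            linarith
        _ = _ := by ring
    · have h9 : |(-(p N * (ξ / σ N)))| * √(M N) = |ξ| * √((p N / σ N) ^ 2 * M N) := by
        rw [Real.sqrt_mul (sq_nonneg _), Real.sqrt_sq (by positivity), abs_neg, abs_mul, abs_div,
          abs_of_pos h0, abs_of_pos e3]
        ring
      rw [h9]
      refine mul_le_mul_of_nonneg_left (Real.sqrt_le_sqrt ?_) (abs_nonneg _)
      have := hM0 N
      calc (p N / σ N) ^ 2 * M N = (p N * M N / σ N * (1 / σ N)) * p N := by ring
        _ ≤ _ := mul_le_of_le_one_right (by positivity) h1.le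
  simpa using hdiff.add hmain

/-! ### The normal distribution function and Kolmogorov distances. -/

lemma stdNormalCDF_eq_real (x : ℝ) : stdNormalCDF x = (gaussianReal 0 1).real (Set.Iic x) :=
  cdf_eq_real _ _

lemma gaussianReal_real_Iic (a x : ℝ) :
    (gaussianReal (-a) 1).real (Set.Iic x) = stdNormalCDF (x + a) := by
  rw [stdNormalCDF_eq_real]
  have h : gaussianReal (-a) 1 = (gaussianReal 0 1).map (· + (-a)) := by
    rw [gaussianReal_map_add_const, zero_add]
  rw [h, map_measureReal_apply (by fun_prop) measurableSet_Iic]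
  congr 1
  ext y
  simp

lemma stdNormalCDF_neg (x : ℝ) : stdNormalCDF (-x) = 1 - stdNormalCDF x := by
  have h : gaussianReal 0 1 = (gaussianReal 0 1).map (fun x => -x) := by
    rw [gaussianReal_map_neg, neg_zero]
  rw [stdNormalCDF_eq_real, stdNormalCDF_eq_real, h,
    map_measureReal_apply (by fun_prop) measurableSet_Iic, ← h]
  have e : (fun x : ℝ => -x) ⁻¹' Set.Iic (-x) = Set.Ici x := by ext y; simp
  rw [e, ← probReal_compl_eq_one_sub measurableSet_Iic, Set.compl_Iic]
  have := nullSingletonClass_gaussianReal (μ := 0) (v := 1) one_ne_zero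
  exact measureReal_congr Ioi_ae_eq_Ici.symm

lemma stdNormalCDF_sub {x y : ℝ} (h : x ≤ y) :
    stdNormalCDF y - stdNormalCDF x = ∫ u in x..y, gaussianPDFReal 0 1 u := by
  rw [intervalIntegral.integral_of_le h, stdNormalCDF_eq_real, stdNormalCDF_eq_real,
    ← measureReal_sdiff (Set.Iic_subset_Iic.mpr h) measurableSet_Iic, Set.Iic_sdiff_Iic,
    Measure.real, gaussianReal_apply_eq_integral 0 one_ne_zero, ENNReal.toReal_ofReal]
  exact integral_nonneg fun u => gaussianPDFReal_nonneg _ _ _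

lemma gaussianPDFReal_le_of_abs_le {x y : ℝ} (h : |x| ≤ |y|) :
    gaussianPDFReal 0 1 y ≤ gaussianPDFReal 0 1 x := by
  simp only [gaussianPDFReal, sub_zero]
  have := sq_le_sq.mpr h
  gcongr

lemma gaussianPDFReal_le_one (x : ℝ) : gaussianPDFReal 0 1 x ≤ 1 := by
  refine (gaussianPDFReal_le_of_abs_le (x := 0) (y := x) (by simp)).trans ?_
  simp only [gaussianPDFReal, sub_zero, NNReal.coe_one, mul_one]
  norm_num
  rw [← mul_inv]
  refine inv_le_one_of_one_le₀ ?_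
  rw [← Real.sqrt_mul Real.pi_pos.le]
  rw [Real.one_le_sqrt]
  linarith [Real.pi_gt_three]

lemma stdNormalCDF_sub_le {x y : ℝ} (h : x ≤ y) : stdNormalCDF y - stdNormalCDF x ≤ y - x := by
  rw [stdNormalCDF_sub h]
  calc _ ≤ ∫ _ in x..y, (1 : ℝ) :=
        intervalIntegral.integral_mono_on h (integrable_gaussianPDFReal 0 1).intervalIntegrable
          (by simp) fun u _ => gaussianPDFReal_le_one u
    _ = _ := by simp

/-- An interval of given length has maximal standard normal probability when it is centred. -/
lemma stdNormalCDF_add_sub_le {a : ℝ} (ha : 0 ≤ a) (x : ℝ) :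
    stdNormalCDF (x + a) - stdNormalCDF x ≤ 2 * stdNormalCDF (a / 2) - 1 := by
  have main : ∀ x, -(a / 2) ≤ x →
      stdNormalCDF (x + a) - stdNormalCDF x ≤ 2 * stdNormalCDF (a / 2) - 1 := by
    intro x hx
    have h1 := stdNormalCDF_sub hx
    have h2 := stdNormalCDF_sub (show -(a / 2) + a ≤ x + a by linarith)
    rw [← intervalIntegral.integral_comp_add_right (fun u => gaussianPDFReal 0 1 u)] at h2
    -- For `u ≥ -a/2`, `|u| ≤ u + a`: sliding the window right from the centre loses at least the
    -- mass it gains.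
    have h3 : ∫ u in -(a / 2)..x, gaussianPDFReal 0 1 (u + a)
        ≤ ∫ u in -(a / 2)..x, gaussianPDFReal 0 1 u :=
      intervalIntegral.integral_mono_on hx
        ((integrable_gaussianPDFReal 0 1).comp_add_right a).intervalIntegrable
        (integrable_gaussianPDFReal 0 1).intervalIntegrable fun u hu =>
          gaussianPDFReal_le_of_abs_le <| by
            rw [abs_of_nonneg (show 0 ≤ u + a by linarith [hu.1])]
            exact abs_le.mpr ⟨by linarith [hu.1], by linarith⟩
    rw [← h1, ← h2, stdNormalCDF_neg, show -(a / 2) + a = a / 2 by ring] at h3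
    linarith
  rcases le_total (-(a / 2)) x with h | h
  · exact main x h
  -- Windows left of the centre are reflected to the right.
  · have := main (-(x + a)) (by linarith)
    rw [show -(x + a) + a = -x by ring, stdNormalCDF_neg, stdNormalCDF_neg] at this
    linarith

/-- If distribution functions converge pointwise to `Φ (· + a)` and `Φ`, then so does their
one-sided Kolmogorov distance. -/
theorem tendsto_kolmogorov {F G : ℕ → ℝ → ℝ} {d : ℕ → ℝ} {a : ℝ} (ha : 0 ≤ a)
    (hF : ∀ N, Monotone (F N)) (hG : ∀ N, Monotone (G N)) (hF1 : ∀ N x, F N x ≤ 1)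
    (hG0 : ∀ N x, 0 ≤ G N x)
    (hFlim : ∀ x, Tendsto (fun N => F N x) atTop (𝓝 (stdNormalCDF (x + a))))
    (hGlim : ∀ x, Tendsto (fun N => G N x) atTop (𝓝 (stdNormalCDF x)))
    (hd : ∀ᶠ N in atTop, ∀ x, F N x - G N x ≤ d N)
    (hd' : ∀ᶠ N in atTop, ∃ x, d N = F N x - G N x) :
    Tendsto d atTop (𝓝 (2 * stdNormalCDF (a / 2) - 1)) := by
  set S := 2 * stdNormalCDF (a / 2) - 1 with hS
  have hS0 : 0 ≤ S := by
    refine le_trans ?_ (stdNormalCDF_add_sub_le ha 0)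
    have : stdNormalCDF 0 ≤ stdNormalCDF (0 + a) := monotone_cdf _ (by linarith)
    linarith
  refine tendsto_order.mpr ⟨fun b hb => ?_, fun b hb => ?_⟩
  -- Lower bound: test at `-a/2`, where the limiting difference is maximal.
  · have h1 := (hFlim (-(a / 2))).sub (hGlim (-(a / 2)))
    rw [stdNormalCDF_neg, show -(a / 2) + a = a / 2 by ring,
      show stdNormalCDF (a / 2) - (1 - stdNormalCDF (a / 2)) = S by rw [hS]; ring] at h1
    filter_upwards [hd, h1.eventually_const_lt hb] with N e1 e2
    exact e2.trans_le (e1 _)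
  -- Upper bound on a finite grid of mesh `ε`. The convergence of `F`, that of `G` and the mesh (`Φ`
  -- is 1-Lipschitz) cost `ε` each; beyond `A` and `B` the difference is below `2ε`.
  · set ε := (b - S) / 4 with hε
    have hε0 : 0 < ε := by rw [hε]; linarith
    obtain ⟨A, hA⟩ : ∃ A, stdNormalCDF (A + a) < ε :=
      (((tendsto_cdf_atBot _).comp (tendsto_atBot_add_const_right _ a tendsto_id)).eventually_lt_const
        hε0).exists
    obtain ⟨B, hB⟩ : ∃ B, 1 - ε < stdNormalCDF B :=
      ((tendsto_cdf_atTop _).eventually_const_lt (by linarith)).exists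
    obtain ⟨m, hm⟩ : ∃ m : ℕ, B ≤ A + m * ε := by
      obtain ⟨m, hm⟩ := exists_nat_ge ((B - A) / ε)
      exact ⟨m, by rw [div_le_iff₀ hε0] at hm; linarith⟩
    have hall : ∀ᶠ N in atTop, ∀ i ∈ range (m + 1),
        F N (A + i * ε) < stdNormalCDF (A + i * ε + a) + ε
        ∧ stdNormalCDF (A + i * ε) - ε < G N (A + i * ε) := by
      rw [Filter.eventually_all_finset]
      intro i _
      exact ((hFlim _).eventually_lt_const (by linarith)).and
        ((hGlim _).eventually_const_lt (by linarith))
    filter_upwards [hall, hd'] with N hN ⟨x, hx⟩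
    rw [hx]
    have hb' : b = S + 4 * ε := by rw [hε]; ring
    rcases lt_or_ge x A with hxA | hxA
    · have h1 := (hN 0 (by simp)).1
      simp only [Nat.cast_zero, zero_mul, add_zero] at h1
      have := hF N hxA.le
      have := hG0 N x
      linarith
    by_cases hxB : A + m * ε ≤ x
    · have h1 := (hN m (by simp)).2
      have h2 : stdNormalCDF B ≤ stdNormalCDF (A + m * ε) := monotone_cdf _ hm
      have := hG N hxB
      have := hF1 N x
      linarith
    push Not at hxB
    set i := ⌊(x - A) / ε⌋₊ with hi
    have hi1 : (i : ℝ) * ε ≤ x - A := by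
      rw [← le_div_iff₀ hε0]
      exact Nat.floor_le (div_nonneg (by linarith) hε0.le)
    have hi2 : x - A < ((i : ℝ) + 1) * ε := by
      rw [← div_lt_iff₀ hε0]
      exact Nat.lt_floor_add_one _
    have him : i < m := by
      have : (i : ℝ) * ε < m * ε := by linarith
      exact_mod_cast lt_of_mul_lt_mul_right this hε0.le
    have h1 := (hN i (by simp; omega)).2
    have h2 := (hN (i + 1) (by simp; omega)).1
    push_cast at h2
    have h3 := hF N (show x ≤ A + (i + 1) * ε by linarith)
    have h4 := hG N (show A + i * ε ≤ x by linarith)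
    have h5 := stdNormalCDF_sub_le (show A + i * ε + a ≤ A + (i + 1) * ε + a by linarith)
    have h6 := stdNormalCDF_add_sub_le ha (A + i * ε)
    linarith

/-! ### From characteristic functions to total variation. -/

/-- Lévy continuity and the portmanteau theorem; the boundary of a half-line is one point, null for
the Gaussian. -/
lemma tendsto_real_Iic_of_tendsto_charFun {μ : ℕ → Measure ℝ} (hμ : ∀ N, IsProbabilityMeasure (μ N))
    {a : ℝ} (h : ∀ ξ, Tendsto (fun N => charFun (μ N) ξ) atTop
      (𝓝 (charFun (gaussianReal (-a) 1) ξ))) (x : ℝ) :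
    Tendsto (fun N => (μ N).real (Set.Iic x)) atTop (𝓝 (stdNormalCDF (x + a))) := by
  let ν : ℕ → ProbabilityMeasure ℝ := fun N => ⟨μ N, hμ N⟩
  let γ : ProbabilityMeasure ℝ := ⟨gaussianReal (-a) 1, inferInstance⟩
  have hw : Tendsto ν atTop (𝓝 γ) := ProbabilityMeasure.tendsto_of_tendsto_charFun h
  have := ProbabilityMeasure.tendsto_measure_of_null_frontier_of_tendsto' hw (E := Set.Iic x) (by
    have := nullSingletonClass_gaussianReal (μ := -a) (v := 1) one_ne_zero
    rw [frontier_Iic]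
    exact measure_singleton (μ := gaussianReal (-a) 1) x)
  rw [← gaussianReal_real_Iic]
  exact (ENNReal.tendsto_toReal (measure_ne_top _ _)).comp this

lemma isProbabilityMeasure_scaledLaw_binMass {p : ℝ} (hp : 0 < p ∧ p < 1) (n : ℕ) (b s : ℝ) :
    IsProbabilityMeasure (scaledLaw n (binMass p n) b s) :=
  isProbabilityMeasure_scaledLaw (binMass_nonneg hp.1.le hp.2 _) (sum_binMass hp.2 le_rfl) _ _

/-- The degenerate mixture concentrated at `u = 0`, with `M = 0` and `a = 0`. -/
lemma tendsto_real_Iic_binMass {n : ℕ → ℕ} {p : ℕ → ℝ} (hp : ∀ N, 0 < p N ∧ p N < 1)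
    (hlim : Tendsto (fun N => (n N : ℝ) * min (p N) (1 - p N)) atTop atTop) (x : ℝ) :
    Tendsto (fun N => (scaledLaw (n N) (binMass (p N) (n N)) (n N * p N)
      (√(n N * p N * (1 - p N)))).real (Set.Iic x)) atTop (𝓝 (stdNormalCDF x)) := by
  have h := tendsto_charFun_scaledLaw_mixMass hp hlim (w := fun _ u => if u = 0 then 1 else 0)
    (M := fun _ => 0) (a := 0) (fun _ u => ite_nonneg zero_le_one le_rfl)
    (fun N => by simp) (fun N => by simp) (fun N => by simp) (by simp)
  have e : ∀ N, mixMass (p N) (n N) (fun u => if u = 0 then 1 else 0) = binMass (p N) (n N) :=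
    fun N => funext (mixMass_single _ _)
  simp only [e] at h
  have := tendsto_real_Iic_of_tendsto_charFun
    (fun N => isProbabilityMeasure_scaledLaw_binMass (hp N) _ _ _) h x
  rwa [add_zero] at this

lemma monotone_real_Iic (μ : Measure ℝ) [IsFiniteMeasure μ] :
    Monotone fun x => μ.real (Set.Iic x) :=
  fun _ _ h => measureReal_mono (Set.Iic_subset_Iic.mpr h)

lemma half_sum_abs_mixMass_tendsto {n : ℕ → ℕ} {p : ℕ → ℝ} (hp : ∀ N, 0 < p N ∧ p N < 1)
    (hlim : Tendsto (fun N => (n N : ℝ) * min (p N) (1 - p N)) atTop atTop)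
    {w : ℕ → ℕ → ℝ} {M : ℕ → ℝ} (hw : ∀ N u, 0 ≤ w N u)
    (hw1 : ∀ N, ∑ u ∈ range (n N + 1), w N u = 1)
    (hM : ∀ N, ∑ u ∈ range (n N + 1), w N u * (u : ℝ) = M N)
    (hM2 : ∀ N, ∑ u ∈ range (n N + 1), w N u * (u * ((u : ℝ) - 1)) ≤ M N ^ 2)
    {a : ℝ} (ha0 : 0 ≤ a)
    (ha : Tendsto (fun N => p N * M N / √(n N * p N * (1 - p N))) atTop (𝓝 a)) :
    Tendsto (fun N => (1 / 2) * ∑ y ∈ range (n N + 1),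
      |mixMass (p N) (n N) (w N) y - binMass (p N) (n N) y|) atTop
      (𝓝 (2 * stdNormalCDF (a / 2) - 1)) := by
  have hσ := tendsto_sqrt_variance hp hlim
  have hμ : ∀ N, IsProbabilityMeasure (scaledLaw (n N) (mixMass (p N) (n N) (w N)) (n N * p N)
      (√(n N * p N * (1 - p N)))) := fun N =>
    isProbabilityMeasure_scaledLaw (mixMass_nonneg (hp N).1.le (hp N).2 _ (hw N))
      (sum_mixMass (hp N).2 _ (hw1 N)) _ _
  have hFlim := tendsto_real_Iic_of_tendsto_charFun hμ
    (tendsto_charFun_scaledLaw_mixMass hp hlim hw hw1 hM hM2 ha)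
  have hGlim := tendsto_real_Iic_binMass hp hlim
  have hν := fun N => isProbabilityMeasure_scaledLaw_binMass (hp N) (n N) (n N * p N)
    (√(n N * p N * (1 - p N)))
  refine tendsto_kolmogorov ha0 (fun N => monotone_real_Iic _) (fun N => monotone_real_Iic _)
    (fun N x => measureReal_le_one) (fun N x => measureReal_nonneg) hFlim hGlim ?_ ?_
  · filter_upwards [hσ.eventually_gt_atTop 0] with N e
    exact (half_sum_abs_mixMass_sub (hp N).1.le (hp N).2 _ (hw N) (hw1 N) _ e).1
  · filter_upwards [hσ.eventually_gt_atTop 0] with N e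
    exact (half_sum_abs_mixMass_sub (hp N).1.le (hp N).2 _ (hw N) (hw1 N) _ e).2

/-! ### The target time and rounding. -/

lemma rate_eq {n₁ n₂ : ℕ} (h₁ : 0 < n₁) :
    rate n₁ n₂ = -Real.log ((n₁ : ℝ) / ((n₁ : ℝ) + n₂)) := by
  have : ((n₁ : ℝ) + n₂) ≠ 0 := by positivity
  rw [rate, one_div, Real.log_inv, one_sub_div this, add_sub_cancel_right]

lemma rate_pos {n₁ n₂ : ℕ} (h₁ : 0 < n₁) (h₂ : 0 < n₂) : 0 < rate n₁ n₂ := by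
  have h1 : (0 : ℝ) < n₁ := by exact_mod_cast h₁
  have h2 : (0 : ℝ) < n₂ := by exact_mod_cast h₂
  rw [rate_eq h₁, neg_pos]
  refine Real.log_neg (by positivity) ?_
  rw [div_lt_one (by positivity)]
  linarith

lemma targetTime_mul_rate {n₁ n₂ : ℕ} (h₁ : 0 < n₁) (h₂ : 0 < n₂) (p : unitInterval) (c : ℝ) :
    targetTime n₁ n₂ p c * rate n₁ n₂
      = (1 / 2) * Real.log (odds p * ((n₁ : ℝ) + n₂)) + c :=
  div_mul_cancel₀ _ (rate_pos h₁ h₂).ne'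

/-- The standardized mean number of coordinates not refreshed after `t` steps. -/
lemma mul_mean_div_sqrt_eq {n₁ n₂ : ℕ} (h₁ : 0 < n₁) (h₂ : 0 < n₂) {p : unitInterval}
    (hp0 : 0 < (p : ℝ)) (hp : (p : ℝ) < 1) (c : ℝ) (t : ℕ) :
    (p : ℝ) * (((n₁ : ℝ) + n₂) * ((n₁ : ℝ) / ((n₁ : ℝ) + n₂)) ^ t)
        / √(((n₁ : ℝ) + n₂) * p * (1 - p))
      = Real.exp (-c - ((t : ℝ) - targetTime n₁ n₂ p c) * rate n₁ n₂) := by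
  have hq : 0 < 1 - (p : ℝ) := by linarith
  have h1 : (0 : ℝ) < n₁ := by exact_mod_cast h₁
  have hn : 0 < (n₁ : ℝ) + n₂ := by positivity
  have ho : 0 < odds p * ((n₁ : ℝ) + n₂) := by unfold odds; positivity
  have e1 : ((n₁ : ℝ) / ((n₁ : ℝ) + n₂)) ^ t = Real.exp (-(t * rate n₁ n₂)) := by
    rw [rate_eq h₁, mul_neg, neg_neg, Real.exp_nat_mul, Real.exp_log (by positivity)]
  -- `pn/σ = √(αn)`, the origin of `½ log(αn)` in the target time.
  have e2 : (p : ℝ) * ((n₁ : ℝ) + n₂) / √(((n₁ : ℝ) + n₂) * p * (1 - p))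
      = Real.exp ((1 / 2) * Real.log (odds p * ((n₁ : ℝ) + n₂))) := by
    rw [mul_comm (1 / 2 : ℝ), Real.exp_mul, Real.exp_log ho, ← Real.sqrt_eq_rpow]
    rw [div_eq_iff (by positivity), ← Real.sqrt_mul ho.le]
    symm
    rw [Real.sqrt_eq_iff_mul_self_eq (by positivity) (by positivity), odds]
    field_simp
  rw [← mul_assoc, mul_div_right_comm, e1, e2, ← Real.exp_add]
  congr 1
  rw [sub_mul, targetTime_mul_rate h₁ h₂]
  ring

lemma tendsto_dTV {n₁ n₂ : ℕ → ℕ} (hn₁ : ∀ N, 0 < n₁ N) (hn₂ : ∀ N, 0 < n₂ N)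
    {p : ℕ → unitInterval} (hp : ∀ N, 0 < (p N : ℝ) ∧ (p N : ℝ) < 1)
    (hlim : Tendsto (fun N => ((n₁ N : ℝ) + n₂ N) * min (p N : ℝ) (1 - p N)) atTop atTop)
    {c : ℝ} {t : ℕ → ℕ}
    (ht : Tendsto (fun N => ((t N : ℝ) - targetTime (n₁ N) (n₂ N) (p N) c)
      * rate (n₁ N) (n₂ N)) atTop (𝓝 0)) :
    Tendsto (fun N => dTV (n₁ N) (n₂ N) (p N) (t N)) atTop
      (𝓝 (2 * stdNormalCDF ((1 / 2) * Real.exp (-c)) - 1)) := by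
  choose w hw0 hw1 hM hM2 hrow using fun N =>
    exists_mixture (hn₁ N) (hn₂ N) (hp N).1 (hp N).2 (t N)
  have hlim' : Tendsto (fun N => ((n₁ N + n₂ N : ℕ) : ℝ) * min (p N : ℝ) (1 - p N)) atTop atTop := by
    simpa only [Nat.cast_add] using hlim
  have ha : Tendsto (fun N => (p N : ℝ)
      * (((n₁ N : ℝ) + n₂ N) * ((n₁ N : ℝ) / ((n₁ N : ℝ) + n₂ N)) ^ t N)
      / √((n₁ N + n₂ N : ℕ) * (p N : ℝ) * (1 - p N))) atTop (𝓝 (Real.exp (-c))) := by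
    have h : Tendsto (fun N => Real.exp (-c - ((t N : ℝ) - targetTime (n₁ N) (n₂ N) (p N) c)
        * rate (n₁ N) (n₂ N))) atTop (𝓝 (Real.exp (-c))) := by
      refine (Real.continuous_exp.tendsto _).comp ?_
      simpa using ht.const_sub (-c)
    refine h.congr fun N => ?_
    rw [Nat.cast_add, mul_mean_div_sqrt_eq (hn₁ N) (hn₂ N) (hp N).1 (hp N).2 c]
  have key := half_sum_abs_mixMass_tendsto hp hlim' hw0 hw1 hM hM2 (Real.exp_pos _).le ha
  rw [one_div_mul_eq_div]
  exact key.congr fun N => (dTV_eq (hp N).2 (hrow N)).symm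

lemma tendsto_rate_zero {n₁ n₂ : ℕ → ℕ}
    (h : Tendsto (fun N => (n₂ N : ℝ) / ((n₁ N : ℝ) + n₂ N)) atTop (𝓝 0)) :
    Tendsto (fun N => rate (n₁ N) (n₂ N)) atTop (𝓝 0) := by
  have h1 : Tendsto (fun N => 1 / (1 - (n₂ N : ℝ) / ((n₁ N : ℝ) + n₂ N))) atTop (𝓝 1) := by
    simpa using (h.const_sub 1).inv₀ (by norm_num)
  have := h1.log one_ne_zero
  rwa [Real.log_one] at this

/-- `αn ≥ n min(p, 1-p)` tends to infinity. Hence truncation of floors and ceilings at `0` is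
eventually harmless. -/
lemma eventually_targetTime_nonneg {n₁ n₂ : ℕ → ℕ} (hn₁ : ∀ N, 0 < n₁ N) (hn₂ : ∀ N, 0 < n₂ N)
    {p : ℕ → unitInterval} (hp : ∀ N, 0 < (p N : ℝ) ∧ (p N : ℝ) < 1)
    (hlim : Tendsto (fun N => ((n₁ N : ℝ) + n₂ N) * min (p N : ℝ) (1 - p N)) atTop atTop)
    (c : ℝ) : ∀ᶠ N in atTop, 0 ≤ targetTime (n₁ N) (n₂ N) (p N) c := by
  have h1 : Tendsto (fun N => odds (p N) * ((n₁ N : ℝ) + n₂ N)) atTop atTop := by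
    refine tendsto_atTop_mono (fun N => ?_) hlim
    have hq : 0 < 1 - (p N : ℝ) := by linarith [(hp N).2]
    rw [mul_comm]
    refine mul_le_mul_of_nonneg_right ((min_le_left _ _).trans ?_) (by positivity)
    rw [odds, le_div_iff₀ hq]
    nlinarith [(hp N).1]
  have h2 := (Real.tendsto_log_atTop.comp h1).eventually_ge_atTop (-(2 * c))
  filter_upwards [h2] with N h
  simp only [Function.comp_apply] at h
  exact div_nonneg (by linarith) (rate_pos (hn₁ N) (hn₂ N)).le

/-- When `n₂/n → 0` the rate vanishes and absorbs a rounding error of at most one step. -/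
lemma tendsto_sub_mul_rate_zero {n₁ n₂ : ℕ → ℕ} (hn₁ : ∀ N, 0 < n₁ N) (hn₂ : ∀ N, 0 < n₂ N)
    (h : Tendsto (fun N => (n₂ N : ℝ) / ((n₁ N : ℝ) + n₂ N)) atTop (𝓝 0))
    {t : ℕ → ℕ} {τ : ℕ → ℝ} (ht : ∀ᶠ N in atTop, |(t N : ℝ) - τ N| ≤ 1) :
    Tendsto (fun N => ((t N : ℝ) - τ N) * rate (n₁ N) (n₂ N)) atTop (𝓝 0) := by
  refine squeeze_zero_norm' ?_ (tendsto_rate_zero h)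
  filter_upwards [ht] with N hN
  have hr := (rate_pos (hn₁ N) (hn₂ N)).le
  rw [norm_mul, Real.norm_eq_abs, Real.norm_of_nonneg hr]
  exact mul_le_of_le_one_left hr hN

end GibbsSampler

theorem mainTheorem2
    (n₁ n₂ : ℕ → ℕ) (hn₁ : ∀ N, 0 < n₁ N) (hn₂ : ∀ N, 0 < n₂ N)
    (p : ℕ → unitInterval) (hp : ∀ N, 0 < (p N : ℝ) ∧ (p N : ℝ) < 1)
    (hlim : Tendsto (fun N => ((n₁ N : ℝ) + n₂ N) * min (p N : ℝ) (1 - p N)) atTop atTop)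
    (c : ℝ) :
    (∀ t : ℕ → ℕ,
      Tendsto
        (fun N => ((t N : ℝ) - GibbsSampler.targetTime (n₁ N) (n₂ N) (p N) c)
          * GibbsSampler.rate (n₁ N) (n₂ N)) atTop (𝓝 0) →
      Tendsto (fun N => GibbsSampler.dTV (n₁ N) (n₂ N) (p N) (t N)) atTop
        (𝓝 (2 * GibbsSampler.stdNormalCDF ((1 / 2) * Real.exp (-c)) - 1))) ∧
    (Tendsto (fun N => (n₂ N : ℝ) / ((n₁ N : ℝ) + n₂ N)) atTop (𝓝 0) →
      Tendsto
        (fun N => GibbsSampler.dTV (n₁ N) (n₂ N) (p N)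
          ⌊GibbsSampler.targetTime (n₁ N) (n₂ N) (p N) c⌋₊) atTop
        (𝓝 (2 * GibbsSampler.stdNormalCDF ((1 / 2) * Real.exp (-c)) - 1)) ∧
      Tendsto
        (fun N => GibbsSampler.dTV (n₁ N) (n₂ N) (p N)
          ⌈GibbsSampler.targetTime (n₁ N) (n₂ N) (p N) c⌉₊) atTop
        (𝓝 (2 * GibbsSampler.stdNormalCDF ((1 / 2) * Real.exp (-c)) - 1))) := by
  have hτ := GibbsSampler.eventually_targetTime_nonneg hn₁ hn₂ hp hlim c
  refine ⟨fun t ht => GibbsSampler.tendsto_dTV hn₁ hn₂ hp hlim ht, fun h => ⟨?_, ?_⟩⟩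
  · refine GibbsSampler.tendsto_dTV hn₁ hn₂ hp hlim (c := c)
      (GibbsSampler.tendsto_sub_mul_rate_zero hn₁ hn₂ h ?_)
    filter_upwards [hτ] with N hN
    have h1 := Nat.floor_le hN
    have h2 := Nat.lt_floor_add_one (GibbsSampler.targetTime (n₁ N) (n₂ N) (p N) c)
    exact abs_le.mpr ⟨by linarith, by linarith⟩
  · refine GibbsSampler.tendsto_dTV hn₁ hn₂ hp hlim (c := c)
      (GibbsSampler.tendsto_sub_mul_rate_zero hn₁ hn₂ h ?_)
    filter_upwards [hτ] with N hN
    have h1 := Nat.le_ceil (GibbsSampler.targetTime (n₁ N) (n₂ N) (p N) c)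
    have h2 := Nat.ceil_lt_add_one hN
    exact abs_le.mpr ⟨by linarith, by linarith⟩
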